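/- Let $(p_k)_{k\in\mathbb N}$, $\mathbb N=\{1,2,\ldots\}$, be a discrete probability distribution with $p_k>0$ for infinitely many $k$. Balls are thrown independently into boxes $1,2,\ldots$, each ball hitting box $k$ with probability $p_k$, and they arrive at the jump times of a Poisson process $(\pi(t))_{t\ge 0}$ of unit intensity which is independent of the choice of the boxes. For $T\ge 0$ and $l\in\mathbb N$ let $K^{*(1)}_T(l)$ be the number of boxes that contain exactly $l$ balls at time $T$. Assume that $$\sum_{k\ge 1}p_k\mathbf 1_{\{p_k\le t\}}\sim t\,g(1/t),\qquad t\to 0+,$$ for some function $g$ which is slowly varying at $\infty$ and satisfies $\lim_{t\to\infty}g(t)=+\infty$. Then each $K^{*(1)}_T(l)$ has a finite mean, and, as $T\to\infty$ (through the reals), $$\Big(\frac{K^{*(1)}_T(l)-\mathbb E K^{*(1)}_T(l)}{(g(T))^{1/2}}\Big)_{l\in\mathbb N}\ \Rightarrow\ (Y_l)_{l\in\mathbb N}$$ weakly in $\mathbb R^\infty=\mathbb R^{\mathbb N}$ with the product topology, where $Y_1,Y_2,\ldots$ are centered, jointly Gaussian random variables with $$\mathbb E Y_l^2=\frac1l\Big(1-\binom{2l}{l}\frac1{2^{2l+1}}\Big),\quad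 l\in\mathbb N,\qquad \mathbb E Y_{l_1}Y_{l_2}=-\frac{1}{(l_1+l_2)2^{l_1+l_2}}\binom{l_1+l_2}{l_1},\quad l_1\ne l_2.$$ -/

import Mathlib

open MeasureTheory ProbabilityTheory Filter Topology Asymptotics
open scoped NNReal

/-- `g` varies slowly at infinity: it is eventually positive and `g (c * x) / g x → 1` as `x → ∞`
for every `c > 0`. Measurability of `g` is not demanded, so the notion covers the usual one. -/
def IsSlowlyVarying (g : ℝ → ℝ) : Prop :=
  (∀ᶠ x in atTop, 0 < g x) ∧
    ∀ c : ℝ, 0 < c → Tendsto (fun x => g (c * x) / g x) atTop (𝓝 1)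

/-- `p` is a discrete probability distribution on the boxes (which are labelled by `0, 1, 2, …`)
with infinitely many boxes of positive probability. -/
structure IsBoxDistribution (p : ℕ → ℝ) : Prop where
  nonneg : ∀ k, 0 ≤ p k
  hasSum : HasSum p 1
  infinite : {k | 0 < p k}.Infinite

/-- The balls `0, 1, 2, …` are thrown independently, and each one falls into box `k` with
probability `p k`; `ξ i` is the box hit by ball `i`. -/
structure IsOccupancyScheme {Ω : Type*} [MeasurableSpace Ω] (p : ℕ → ℝ) (ξ : ℕ → Ω → ℕ)
    (P : Measure Ω) : Prop where
  measurable : ∀ i, Measurable (ξ i)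
  indep : iIndepFun ξ P
  law : ∀ i k, P.real {ω | ξ i ω = k} = p k

/-- `π` is a Poisson process of unit intensity: almost all paths are nondecreasing, right-continuous
and start at `0`, the increments are independent, and the increment over `[s, t]` has the Poisson
law with mean `t - s`. (As almost all paths are nondecreasing, the truncated subtraction in `ℕ`
gives the true increments almost surely.) -/
structure IsUnitPoissonProcess {Ω : Type*} [MeasurableSpace Ω] (π : ℝ≥0 → Ω → ℕ)
    (P : Measure Ω) : Prop where
  measurable : ∀ t, Measurable (π t)
  zero : ∀ᵐ ω ∂P, π 0 ω = 0
  monotone : ∀ᵐ ω ∂P, Monotone fun t => π t ω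
  rightContinuous : ∀ᵐ ω ∂P, ∀ t, ContinuousWithinAt (fun s => π s ω) (Set.Ici t) t
  indepIncrements : HasIndepIncrements π P
  law : ∀ s t, s ≤ t → HasLaw (fun ω => π t ω - π s ω) (poissonMeasure (t - s)) P

/-- The number of the first `n` balls that fell into box `k`. -/
def ballCount {Ω : Type*} (ξ : ℕ → Ω → ℕ) (n k : ℕ) (ω : Ω) : ℕ :=
  ((Finset.range n).filter fun i => ξ i ω = k).card

/-- The number of boxes that contain exactly `l` of the first `n` balls. The set of these boxes is
finite, as `l` is positive. -/
noncomputable def smallCount {Ω : Type*} (ξ : ℕ → Ω → ℕ) (n : ℕ) (l : ℕ+) (ω : Ω) : ℕ :=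
  {k : ℕ | ballCount ξ n k ω = l}.ncard

/-- The number of boxes that contain exactly `l` balls at time `t` when the balls arrive at the jump
times of `π`. -/
noncomputable def poissonSmallCount {Ω : Type*} (ξ : ℕ → Ω → ℕ) (π : ℝ≥0 → Ω → ℕ) (t : ℝ≥0)
    (l : ℕ+) (ω : Ω) : ℕ :=
  smallCount ξ (π t ω) l ω

/-! The proof is Poissonization followed by a central limit theorem with a trivial Lindeberg
condition. At time `T` the number of balls is Poisson with mean `T` and independent of the choice of
boxes, so the occupancy numbers are independent, box `k` having the Poisson law of mean `T * p k`
(`iIndepFun_ballCount`, `hasLaw_ballCount`). A linear combination of centered counts is therefore a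
series of independent centered terms, one for each box, bounded uniformly in the box and in `T`.
After division by `√(g T)` the terms are uniformly small, and the characteristic function differs
from the Gaussian one by at most the bound on the terms times the variance
(`norm_integral_exp_hasSum_sub_exp_le`).

It remains to find the limit of the variance. The covariances are sums over `k` of functions `x ^ (j
+ 1) * exp (-lam * x)` at `x = T * p k`, with `lam = 1` or `lam = 2`. By hypothesis and slow
variation, the measure with mass `T * p k / g T` at each point `T * p k` tends to Lebesgue measure
on the half-line (`tendsto_lowMass_div`). Hence such a sum, divided by `g T`, tends to the integral
of `y ^ j * exp (-lam * y)`, which is `j! / lam ^ (j + 1)` (`tendsto_tsum_pow_mul_exp_neg`). The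
factorials combine into `limitCov`.

Being a limit of covariances, `limitCov` is positive semidefinite, so a Gaussian process with this
covariance exists (`exists_isGaussianProcess`). In a countable product of lines, weak convergence
follows from that of the finite-dimensional characteristic functions
(`tendstoInDistribution_pi_of_tendsto_charFun`). -/

/-! ### Weak convergence in a countable product of lines -/

/-- The base of the largest open cylinder over the coordinates in `I` that is contained in `G`. -/
def openCylinderBase {ι : Type*} (G : Set (ι → ℝ)) (I : Finset ι) : Set (I → ℝ) :=
  interior {y | ∀ x : ι → ℝ, I.restrict x = y → x ∈ G}

/-- The largest open cylinder over the coordinates in `I` that is contained in `G`. -/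
def openCylinder {ι : Type*} (G : Set (ι → ℝ)) (I : Finset ι) : Set (ι → ℝ) :=
  I.restrict (π := fun _ => ℝ) ⁻¹' openCylinderBase G I

lemma openCylinder_subset {ι : Type*} (G : Set (ι → ℝ)) (I : Finset ι) :
    openCylinder G I ⊆ G :=
  fun x hx => interior_subset (s := {y | ∀ x : ι → ℝ, I.restrict x = y → x ∈ G}) hx x rfl

lemma monotone_openCylinder {ι : Type*} (G : Set (ι → ℝ)) : Monotone (openCylinder G) := by
  intro I J hIJ x hx
  have hc : Continuous (Finset.restrict₂ (π := fun _ => ℝ) hIJ) :=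
    continuous_pi fun i => continuous_apply _
  refine interior_maximal ?_ (isOpen_interior.preimage hc) (a := J.restrict x)
    (show Finset.restrict₂ (π := fun _ => ℝ) hIJ (J.restrict x) ∈ openCylinderBase G I from hx)
  rintro y hy z rfl
  exact openCylinder_subset G I hy

/-- A basic neighbourhood in the product topology restricts only finitely many coordinates. With
monotonicity in `I`, this exhausts an open set by a directed family of open cylinders. -/
lemma iUnion_openCylinder {ι : Type*} {G : Set (ι → ℝ)} (hG : IsOpen G) :
    ⋃ I : Finset ι, openCylinder G I = G := by
  apply Set.Subset.antisymm
  · exact Set.iUnion_subset fun I => openCylinder_subset G I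
  · intro x hx
    obtain ⟨I, u, hu, huG⟩ := isOpen_pi_iff.1 hG x hx
    refine Set.mem_iUnion.2 ⟨I, ?_⟩
    have ho : IsOpen (Set.univ.pi fun i : I => u i) :=
      isOpen_set_pi Set.finite_univ fun i _ => (hu i i.2).1
    refine interior_maximal ?_ ho (a := I.restrict x) fun i _ => (hu i i.2).2
    rintro y hy z rfl
    exact huG fun i hi => hy ⟨i, hi⟩ trivial

/-- The projection of a product of real lines onto finitely many coordinates, as a map into a
Euclidean space. -/
noncomputable def euclideanRestrict {ι : Type*} (I : Finset ι) (x : ι → ℝ) : EuclideanSpace ℝ I :=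
  WithLp.toLp 2 (I.restrict x)

lemma measurable_euclideanRestrict {ι : Type*} (I : Finset ι) :
    Measurable (euclideanRestrict I) :=
  (by fun_prop : Measurable (fun y : I → ℝ => (WithLp.toLp 2 y : EuclideanSpace ℝ I))).comp
    (Finset.measurable_restrict I)

open scoped Classical in
-- The frequency is extended by zero outside `I`, so that the exponent is a sum with coefficients
-- defined on all of `ι`.
lemma charFun_map_euclideanRestrict {ι Ω : Type*} [MeasurableSpace Ω] {Q : Measure Ω}
    {W : Ω → ι → ℝ} (hW : AEMeasurable W Q) (I : Finset ι) (t : EuclideanSpace ℝ I) :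
    charFun ((Q.map W).map (euclideanRestrict I)) t = ∫ ω, Complex.exp
      ((∑ i ∈ I, (fun i => if hi : i ∈ I then t ⟨i, hi⟩ else 0) i * W ω i : ℝ)
        * Complex.I) ∂Q := by
  rw [charFun_apply, integral_map (measurable_euclideanRestrict I).aemeasurable
    (Continuous.aestronglyMeasurable (by fun_prop)), integral_map hW]
  · congr 1 with ω
    congr 3
    rw [← Finset.sum_coe_sort I, PiLp.inner_apply]
    refine Finset.sum_congr rfl fun i _ => ?_
    simp [euclideanRestrict]
  · refine Measurable.aestronglyMeasurable ?_
    exact (Continuous.measurable (f := fun x : EuclideanSpace ℝ I =>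
      Complex.exp ((inner ℝ x t : ℝ) * Complex.I)) (by fun_prop)).comp
      (measurable_euclideanRestrict I)

/-- Convergence of the finite-dimensional characteristic functions implies convergence in
distribution in a countable product of real lines. -/
theorem tendstoInDistribution_pi_of_tendsto_charFun {ι κ Ω Ω' : Type*} [Countable ι]
    {l : Filter κ} [l.IsCountablyGenerated] {mΩ : MeasurableSpace Ω} {mΩ' : MeasurableSpace Ω'}
    {P : Measure Ω} {P' : Measure Ω'} [IsProbabilityMeasure P] [IsProbabilityMeasure P']
    {X : κ → Ω → ι → ℝ} {Z : Ω' → ι → ℝ}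
    (hX : ∀ n, AEMeasurable (X n) P) (hZ : AEMeasurable Z P')
    (h : ∀ (I : Finset ι) (t : ι → ℝ),
      Tendsto (fun n => ∫ ω, Complex.exp ((∑ i ∈ I, t i * X n ω i : ℝ) * Complex.I) ∂P) l
        (𝓝 (∫ ω, Complex.exp ((∑ i ∈ I, t i * Z ω i : ℝ) * Complex.I) ∂P'))) :
    TendstoInDistribution X l Z (fun _ => P) P' where
  forall_aemeasurable := hX
  aemeasurable_limit := hZ
  tendsto := by
    -- Portmanteau: the lower bound for `G` follows from the bounds for the cylinders inside it,
    -- which depend on finitely many coordinates.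
    refine tendsto_of_forall_isOpen_le_liminf' fun G hG => ?_
    have hL (I : Finset ι) := measurable_euclideanRestrict I
    let V (I : Finset ι) : Set (EuclideanSpace ℝ I) := WithLp.ofLp ⁻¹' openCylinderBase G I
    have hV (I : Finset ι) : IsOpen (V I) :=
      isOpen_interior.preimage (PiLp.continuous_ofLp 2 _)
    have hpre (I : Finset ι) : openCylinder G I = euclideanRestrict I ⁻¹' V I := rfl
    have hconv (I : Finset ι) : Tendsto (β := ProbabilityMeasure (EuclideanSpace ℝ I))
        (fun n => ⟨((P.map (X n)).map (euclideanRestrict I)), by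
          have := Measure.isProbabilityMeasure_map (hX n)
          exact Measure.isProbabilityMeasure_map (hL I).aemeasurable⟩) l
        (𝓝 ⟨(P'.map Z).map (euclideanRestrict I), by
          have := Measure.isProbabilityMeasure_map hZ
          exact Measure.isProbabilityMeasure_map (hL I).aemeasurable⟩) := by
      -- A countably generated filter can be tested on sequences, to which Lévy's continuity theorem
      -- applies.
      refine tendsto_of_seq_tendsto fun u hu => ?_
      refine ProbabilityMeasure.tendsto_of_tendsto_charFun fun t => ?_
      simp only [ProbabilityMeasure.coe_mk]
      rw [charFun_map_euclideanRestrict hZ I t]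
      exact ((h I _).comp hu).congr fun n =>
        (charFun_map_euclideanRestrict (hX (u n)) I t).symm
    simp only [ProbabilityMeasure.coe_mk]
    conv_lhs => rw [← iUnion_openCylinder hG]
    rw [(monotone_openCylinder G).directed_le.measure_iUnion]
    refine iSup_le fun I => ?_
    have h1 := ProbabilityMeasure.le_liminf_measure_open_of_tendsto (hconv I) (hV I)
    simp only [ProbabilityMeasure.coe_mk] at h1
    rw [Measure.map_apply (hL I) (hV I).measurableSet] at h1
    refine h1.trans (liminf_le_liminf (Eventually.of_forall fun n => ?_))
    rw [Measure.map_apply (hL I) (hV I).measurableSet]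
    exact measure_mono (openCylinder_subset G I)

/-! ### Gaussian processes with a prescribed covariance -/

section GramSchmidt

variable {ι H : Type*} [LinearOrder ι] [LocallyFiniteOrderBot ι] [WellFoundedLT ι]
  [NormedAddCommGroup H] [InnerProductSpace ℝ H]

open InnerProductSpace

lemma inner_gramSchmidtNormed_smul (v : ι → H) (j : ι) (x : H) :
    inner ℝ (gramSchmidtNormed ℝ v j) x • gramSchmidtNormed ℝ v j =
      (inner ℝ (gramSchmidt ℝ v j) x / ‖gramSchmidt ℝ v j‖ ^ 2) • gramSchmidt ℝ v j := by
  simp only [gramSchmidtNormed, inner_smul_left, smul_smul]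
  congr 1
  simp
  ring

/-- Linear independence is not needed: where a Gram–Schmidt vector vanishes, so does its
normalization, and the corresponding term is zero. -/
lemma eq_sum_inner_gramSchmidtNormed (v : ι → H) (l : ι) :
    v l = ∑ j ∈ Finset.Iic l,
      inner ℝ (gramSchmidtNormed ℝ v j) (v l) • gramSchmidtNormed ℝ v j := by
  simp_rw [inner_gramSchmidtNormed_smul]
  rw [← Finset.Iio_insert, Finset.sum_insert (by simp)]
  have h := gramSchmidt_def'' ℝ v l
  have h2 : inner ℝ (gramSchmidt ℝ v l) (v l) = ‖gramSchmidt ℝ v l‖ ^ 2 := by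
    conv_lhs => rw [h]
    rw [inner_add_right, inner_sum, real_inner_self_eq_norm_sq, add_eq_left]
    refine Finset.sum_eq_zero fun i hi => ?_
    rw [inner_smul_right, gramSchmidt_orthogonal ℝ v (Finset.mem_Iio.1 hi).ne', mul_zero]
  conv_lhs => rw [h]
  congr 1
  rw [h2]
  by_cases h0 : gramSchmidt ℝ v l = 0
  · simp [h0]
  · rw [div_self (by simpa using h0), one_smul]

/-- This is the Cholesky factorization of the Gram matrix. The factor is triangular, which keeps the
sums finite. -/
lemma inner_eq_sum_inner_gramSchmidtNormed (v : ι → H) (l m : ι) :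
    inner ℝ (v l) (v m) = ∑ j ∈ Finset.Iic l,
      inner ℝ (gramSchmidtNormed ℝ v j) (v l) * inner ℝ (gramSchmidtNormed ℝ v j) (v m) := by
  conv_lhs => rw [eq_sum_inner_gramSchmidtNormed v l]
  simp [sum_inner, inner_smul_left]

lemma inner_gramSchmidtNormed_of_lt (v : ι → H) {i j : ι} (h : i < j) :
    inner ℝ (gramSchmidtNormed ℝ v j) (v i) = 0 := by
  simp [gramSchmidtNormed, inner_smul_left, gramSchmidt_inv_triangular ℝ v h]

end GramSchmidt

open scoped ComplexOrder in
/-- A real positive semidefinite kernel is the Gram matrix of a family of vectors of a Hilbert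
space. -/
lemma exists_gram_of_posSemidef {ι : Type} {c : ι → ι → ℝ} (hsymm : ∀ i j, c i j = c j i)
    (hpos : ∀ (I : Finset ι) (t : ι → ℝ), 0 ≤ ∑ i ∈ I, ∑ j ∈ I, t i * t j * c i j) :
    ∃ (H : Type) (_ : NormedAddCommGroup H) (_ : InnerProductSpace ℝ H) (v : ι → H),
      ∀ i j, inner ℝ (v i) (v j) = c i j := by
  -- The scalar kernel acts by multiplication on `ℝ`; the vectors sought are the kernel functions,
  -- at the scalar `1`, of its reproducing kernel Hilbert space.
  let K : Matrix ι ι (ℝ →L[ℝ] ℝ) := .of fun x y => c x y • ContinuousLinearMap.id ℝ ℝ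
  have hherm : K.IsHermitian := by
    ext x y
    simp [K, Matrix.conjTranspose_apply, hsymm x y, ContinuousLinearMap.star_eq_adjoint,
      ContinuousLinearMap.adjoint_id]
  have hK : K.PosSemidef := by
    have htfae := (RKHS.posSemidef_tfae (K := K)).out 0 2
    refine htfae.2 ⟨hherm, fun t => ?_⟩
    refine (hpos t.support t).trans_eq ?_
    simp only [Finsupp.sum, K, Matrix.of_apply]
    simp only [RCLike.re_to_real]
    refine Finset.sum_congr rfl fun i _ => Finset.sum_congr rfl fun j _ => ?_
    simp [hsymm i j]
    ring
  have : Fact K.PosSemidef := ⟨hK⟩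
  refine ⟨RKHS.OfKernel K, inferInstance, inferInstance,
    fun i => RKHS.kerFun (RKHS.OfKernel K) i (1 : ℝ), fun i j => ?_⟩
  rw [← RKHS.kernel_inner, RKHS.OfKernel.kernel_ofKernel]
  simp [K, hsymm i j]

/-- Every positive semidefinite kernel is the covariance of a centered Gaussian process. -/
theorem exists_isGaussianProcess {ι : Type} [LinearOrder ι] [LocallyFiniteOrderBot ι]
    [WellFoundedLT ι] {c : ι → ι → ℝ} (hsymm : ∀ i j, c i j = c j i)
    (hpos : ∀ (I : Finset ι) (t : ι → ℝ), 0 ≤ ∑ i ∈ I, ∑ j ∈ I, t i * t j * c i j) :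
    ∃ (Ω' : Type) (_ : MeasurableSpace Ω') (P' : Measure Ω') (_ : IsProbabilityMeasure P')
      (Y : ι → Ω' → ℝ), IsGaussianProcess Y P' ∧ (∀ i, Measurable (Y i)) ∧
      (∀ i, ∫ ω, Y i ω ∂P' = 0) ∧ ∀ i j, ∫ ω, Y i ω * Y j ω ∂P' = c i j := by
  obtain ⟨H, _, _, v, hv⟩ := exists_gram_of_posSemidef hsymm hpos
  obtain ⟨Ω', mΩ', P', Z, hZm, hZ, hZi, hP'⟩ := exists_iid ι (gaussianReal 0 1)
  have hG (i : ι) : HasGaussianLaw (Z i) P' := (hZ i).hasGaussianLaw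
  have hproc : IsGaussianProcess Z P' :=
    ⟨fun I => (hZi.precomp (g := ((↑) : I → ι)) Subtype.val_injective).hasGaussianLaw
      fun i => hG i⟩
  -- The Cholesky factor of `c`. Its rows are applied to independent standard normals; each row uses
  -- only the finitely many indices up to `l`.
  let a (l j : ι) : ℝ := inner ℝ (InnerProductSpace.gramSchmidtNormed ℝ v j) (v l)
  have hint (i : ι) : Integrable (Z i) P' := (hG i).integrable
  have hint2 (i j : ι) : Integrable (fun ω => Z i ω * Z j ω) P' :=
    (hG i).memLp_two.integrable_mul (hG j).memLp_two
  have hmean (i : ι) : ∫ ω, Z i ω ∂P' = 0 := by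
    rw [(hZ i).integral_eq, integral_id_gaussianReal]
  have hcov (i j : ι) : ∫ ω, Z i ω * Z j ω ∂P' = if i = j then 1 else 0 := by
    split_ifs with h
    · subst h
      have h1 := (hZ i).variance_eq
      rw [variance_id_gaussianReal, variance_of_integral_eq_zero (hint i).aemeasurable (hmean i)]
        at h1
      simpa [sq] using h1
    · have := (hZi.indepFun h).integral_fun_mul_eq_mul_integral (hint i).aestronglyMeasurable
        (hint j).aestronglyMeasurable
      rw [this, hmean, zero_mul]
  refine ⟨Ω', mΩ', P', hP', fun l ω => ∑ j ∈ Finset.Iic l, a l j * Z j ω, ?_, ?_, ?_, ?_⟩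
  · refine hproc.of_isGaussianProcess fun l => ⟨Finset.Iic l,
      ∑ j : Finset.Iic l, a l j • ContinuousLinearMap.proj j, fun ω => ?_⟩
    rw [← Finset.sum_coe_sort]
    simp
  · exact fun i => Finset.measurable_fun_sum _ fun j _ => (hZm j).const_mul _
  · intro i
    rw [integral_finsetSum _ fun j _ => (hint j).const_mul _]
    simp [integral_const_mul, hmean]
  · intro l m
    simp_rw [Finset.sum_mul_sum]
    have hterm (i j : ι) : Integrable (fun ω => a l i * Z i ω * (a m j * Z j ω)) P' :=
      ((hint2 i j).const_mul (a l i * a m j)).congr (Eventually.of_forall fun ω => by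
        simp only; ring)
    rw [integral_finsetSum _ fun i _ => integrable_finsetSum _ fun j _ => hterm i j,
      ← hv, inner_eq_sum_inner_gramSchmidtNormed]
    refine Finset.sum_congr rfl fun i _ => ?_
    rw [integral_finsetSum _ fun j _ => hterm i j]
    have (j : ι) : ∫ ω, a l i * Z i ω * (a m j * Z j ω) ∂P' =
        if i = j then a l i * a m j else 0 := by
      rw [show (fun ω => a l i * Z i ω * (a m j * Z j ω)) =
        fun ω => a l i * a m j * (Z i ω * Z j ω) from funext fun ω => by ring,
        integral_const_mul, hcov]
      simp
    simp_rw [this]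
    rw [Finset.sum_ite_eq]
    split_ifs with h
    · rfl
    · have : a m i = 0 := inner_gramSchmidtNormed_of_lt v (by simpa using h)
      rw [show inner ℝ (InnerProductSpace.gramSchmidtNormed ℝ v i) (v m) = 0 from this, mul_zero]

/-! ### Mass of small terms: layer cake and growth -/

/-- The total mass of the terms of `x` that are at most `y`. -/
noncomputable def lowMass (x : ℕ → ℝ) (y : ℝ) : ℝ := ∑' k, Set.indicator {k | x k ≤ y} x k

section LowMass

variable {x : ℕ → ℝ}

lemma summable_lowMass (hx : Summable x) (y : ℝ) :
    Summable (Set.indicator {k | x k ≤ y} x) := hx.indicator _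

lemma lowMass_nonneg (h0 : ∀ k, 0 ≤ x k) (y : ℝ) : 0 ≤ lowMass x y :=
  tsum_nonneg fun k => Set.indicator_nonneg (fun k _ => h0 k) k

lemma monotone_lowMass (h0 : ∀ k, 0 ≤ x k) (hx : Summable x) : Monotone (lowMass x) :=
  fun _ _ hab => (summable_lowMass hx _).tsum_le_tsum
    (fun k => Set.indicator_le_indicator_of_subset (fun _ hk => le_trans hk hab) (h0 ·) k)
    (summable_lowMass hx _)

lemma lowMass_le_tsum (h0 : ∀ k, 0 ≤ x k) (hx : Summable x) (y : ℝ) : lowMass x y ≤ ∑' k, x k :=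
  (summable_lowMass hx _).tsum_le_tsum (fun k => Set.indicator_le_self' (fun k _ => h0 k) k) hx

lemma lowMass_const_mul {T : ℝ} (hT : 0 < T) (y : ℝ) :
    lowMass (fun k => T * x k) y = T * lowMass x (y / T) := by
  rw [lowMass, lowMass, ← tsum_mul_left]
  congr 1 with k
  by_cases h : x k ≤ y / T
  · have h' : T * x k ≤ y := by rwa [le_div_iff₀' hT] at h
    simp [Set.indicator, h, h']
  · have h' : ¬ T * x k ≤ y := by rwa [le_div_iff₀' hT] at h
    simp [Set.indicator, h, h']

lemma lowMass_pos (h0 : ∀ k, 0 ≤ x k) (hx : Summable x) (hinf : {k | 0 < x k}.Infinite)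
    {t : ℝ} (ht : 0 < t) : 0 < lowMass x t := by
  have h1 : ∀ᶠ k in cofinite, x k < t := hx.tendsto_cofinite_zero.eventually_lt_const ht
  obtain ⟨k, hk, hkt⟩ := ((frequently_cofinite_iff_infinite.2 hinf).and_eventually h1).exists
  refine (summable_lowMass hx t).tsum_pos (fun k => Set.indicator_nonneg (fun k _ => h0 k) k) k ?_
  rwa [Set.indicator_of_mem (show k ∈ {k | x k ≤ t} from hkt.le)]

/-- Layer cake formula. -/
lemma hasSum_mul_integral_Ioi (h0 : ∀ k, 0 ≤ x k) (hx : Summable x) {φ : ℝ → ℝ}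
    (hφ : IntegrableOn φ (Set.Ioi 0)) :
    HasSum (fun k => x k * ∫ y in Set.Ioi (x k), φ y)
      (∫ y in Set.Ioi 0, φ y * lowMass x y) := by
  have hind (k : ℕ) (y : ℝ) : φ y * Set.indicator {k | x k ≤ y} x k =
      x k * (Set.Ici (x k)).indicator φ y := by
    by_cases h : x k ≤ y <;> simp [Set.indicator, h, mul_comm]
  have hint (k : ℕ) : IntegrableOn (fun y => φ y * Set.indicator {k | x k ≤ y} x k)
      (Set.Ioi 0) := by
    simp_rw [hind]
    exact (hφ.indicator measurableSet_Ici).const_mul _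
  -- Sum and integral may be exchanged because the `k`-th term has L¹ norm at most `x k * ∫ ‖φ‖`.
  have key := hasSum_integral_of_summable_integral_norm (μ := volume.restrict (Set.Ioi 0))
    (F := fun k y => φ y * Set.indicator {k | x k ≤ y} x k) hint ?_
  · have hs : ∫ y in Set.Ioi 0, φ y * lowMass x y = ∫ y in Set.Ioi 0,
        ∑' k, φ y * Set.indicator {k | x k ≤ y} x k := by simp_rw [lowMass, tsum_mul_left]
    rw [hs]
    refine key.congr_fun fun k => ?_
    simp_rw [hind]
    rw [integral_const_mul, integral_indicator measurableSet_Ici,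
      Measure.restrict_restrict measurableSet_Ici, ← integral_Ici_eq_integral_Ioi]
    rcases (h0 k).eq_or_lt with h | h
    · simp [← h]
    · rw [Set.inter_eq_left.2]
      exact fun y hy => lt_of_lt_of_le h hy
  · refine Summable.of_nonneg_of_le (fun k => by positivity) (fun k => ?_)
      (hx.mul_right (∫ y in Set.Ioi 0, ‖φ y‖))
    rw [← integral_const_mul]
    refine integral_mono (hint k).norm (hφ.norm.const_mul _) fun y => ?_
    simp only [hind, norm_mul, Real.norm_of_nonneg (h0 k)]
    gcongr
    · exact h0 k
    · exact norm_indicator_le_norm_self _ _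

/-- A doubling function has at most polynomial growth. -/
lemma exists_lowMass_mul_le (h0 : ∀ k, 0 ≤ x k) (hx : Summable x) {C : ℝ}
    (hC : ∀ t, 0 < t → lowMass x (2 * t) ≤ C * lowMass x t) :
    ∃ N : ℕ, ∀ t, 0 < t → ∀ y, 0 ≤ y →
      lowMass x (y * t) ≤ (2 * (1 + y)) ^ N * lowMass x t := by
  -- Once `C` is enlarged to `2 ^ N`, the cost `(2 ^ n) ^ N` of `n` doublings is a power of the
  -- dilation `2 ^ n`.
  obtain ⟨N, hN⟩ := pow_unbounded_of_one_lt C (one_lt_two : (1 : ℝ) < 2)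
  have hm := monotone_lowMass h0 hx
  have hstep (n : ℕ) (t : ℝ) (ht : 0 < t) :
      lowMass x (2 ^ n * t) ≤ (2 ^ n) ^ N * lowMass x t := by
    induction n with
    | zero => simp
    | succ n ih =>
      have h1 := hC (2 ^ n * t) (by positivity)
      rw [← mul_assoc, ← pow_succ'] at h1
      have h2 : lowMass x (2 ^ (n + 1) * t) ≤ 2 ^ N * lowMass x (2 ^ n * t) :=
        h1.trans (by gcongr; exact lowMass_nonneg h0 _)
      calc _ ≤ 2 ^ N * ((2 ^ n) ^ N * lowMass x t) := h2.trans (by gcongr)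
        _ = _ := by rw [pow_succ 2 n, mul_pow]; ring
  refine ⟨N, fun t ht y hy => ?_⟩
  have hl := lowMass_nonneg h0 t
  rcases le_total y 1 with h | h
  · calc lowMass x (y * t) ≤ 1 * lowMass x t := by
          rw [one_mul]; exact hm (by nlinarith)
      _ ≤ _ := by gcongr; exact one_le_pow₀ (by linarith)
  · obtain ⟨n, hn1, hn2⟩ := exists_nat_pow_near h (one_lt_two : (1 : ℝ) < 2)
    calc lowMass x (y * t) ≤ lowMass x (2 ^ (n + 1) * t) := hm (by gcongr)
      _ ≤ (2 ^ (n + 1)) ^ N * lowMass x t := hstep _ t ht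
      _ ≤ _ := by
        gcongr
        rw [pow_succ]
        linarith

end LowMass

/-! ### Consequences of slow variation -/

section Scaling

variable {p : ℕ → ℝ} {g : ℝ → ℝ}

/-- At `t = y / T` the hypothesis gives `(y / T) * g (T / y)`, and slow variation replaces `g (T /
y)` by `g T`. The limit `y` is the distribution function of Lebesgue measure. -/
lemma tendsto_lowMass_div (hg : IsSlowlyVarying g)
    (hB : lowMass p ~[𝓝[>] 0] fun t : ℝ => t * g (1 / t)) {y : ℝ} (hy : 0 < y) :
    Tendsto (fun T => T * lowMass p (y / T) / g T) atTop (𝓝 y) := by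
  have hto : Tendsto (fun T : ℝ => y / T) atTop (𝓝[>] 0) := by
    refine tendsto_nhdsWithin_iff.2 ⟨tendsto_const_nhds.div_atTop tendsto_id, ?_⟩
    filter_upwards [eventually_gt_atTop 0] with T hT
    exact div_pos hy hT
  have hgy : ∀ᶠ T : ℝ in atTop, 0 < g (y⁻¹ * T) :=
    (tendsto_id.const_mul_atTop (inv_pos.2 hy)).eventually hg.1
  have h1 := hB.comp_tendsto hto
  rw [isEquivalent_iff_tendsto_one] at h1
  · have h2 := (h1.mul_const y).mul (hg.2 y⁻¹ (inv_pos.2 hy))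
    simp only [one_mul, mul_one] at h2
    refine h2.congr' ?_
    filter_upwards [eventually_gt_atTop 0, hgy, hg.1] with T hT h3 h4
    simp only [Pi.div_apply, Function.comp_apply, one_div_div]
    rw [← div_eq_inv_mul] at h3 ⊢
    have h5 := h3.ne'
    field_simp
  · filter_upwards [eventually_gt_atTop 0, hgy] with T hT h3
    simp only [Function.comp_apply, one_div_div, div_eq_inv_mul T y]
    positivity

/-- For small `t` the ratio of the two masses tends to `2`. For the other `t` the total mass bounds
the numerator and the positive mass at the threshold bounds the denominator from below. -/
lemma exists_lowMass_doubling (h0 : ∀ k, 0 ≤ p k) (hp : Summable p)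
    (hinf : {k | 0 < p k}.Infinite) (hg : IsSlowlyVarying g)
    (hB : lowMass p ~[𝓝[>] 0] fun t : ℝ => t * g (1 / t)) :
    ∃ C, ∀ t, 0 < t → lowMass p (2 * t) ≤ C * lowMass p t := by
  have h1 := tendsto_lowMass_div hg hB one_pos
  have h2 := tendsto_lowMass_div hg hB two_pos
  have h3 : ∀ᶠ T : ℝ in atTop, lowMass p (2 / T) ≤ 4 * lowMass p (1 / T) := by
    -- The limits are `1` and `2`; the bounds `3 / 4` and `3` have ratio `4`.
    filter_upwards [h1.eventually_const_le (show (3 / 4 : ℝ) < 1 by norm_num),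
      h2.eventually_le_const (show (2 : ℝ) < 3 by norm_num), eventually_gt_atTop 0, hg.1]
      with T ha hb hT hgT
    rw [le_div_iff₀ hgT] at ha
    rw [div_le_iff₀ hgT] at hb
    nlinarith
  obtain ⟨T₀, hT₀⟩ := eventually_atTop.1 (h3.and (eventually_gt_atTop 0))
  have hT₀pos := (hT₀ T₀ le_rfl).2
  have hpos := lowMass_pos h0 hp hinf (one_div_pos.2 hT₀pos)
  refine ⟨max 4 ((∑' k, p k) / lowMass p (1 / T₀)), fun t ht => ?_⟩
  have hl := lowMass_nonneg h0 t
  rcases le_total t (1 / T₀) with h | h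
  · have h4 := (hT₀ (1 / t) ((le_one_div hT₀pos ht).2 h)).1
    rw [one_div_one_div, div_div_eq_mul_div, div_one] at h4
    exact h4.trans (by gcongr; exact le_max_left _ _)
  · calc lowMass p (2 * t) ≤ ∑' k, p k := lowMass_le_tsum h0 hp _
      _ = (∑' k, p k) / lowMass p (1 / T₀) * lowMass p (1 / T₀) := by field_simp
      _ ≤ max 4 ((∑' k, p k) / lowMass p (1 / T₀)) * lowMass p t := by
        gcongr
        · exact le_max_right _ _
        · exact monotone_lowMass h0 hp h

end Scaling

/-! ### Integrals of polynomials times exponentials -/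

section ExpPoly

variable {lam : ℝ}

lemma integrableOn_one_add_pow_mul_exp_neg (M : ℕ) (hl : 0 < lam) :
    IntegrableOn (fun y : ℝ => (1 + y) ^ M * Real.exp (-(lam * y))) (Set.Ioi 0) := by
  refine integrable_of_isBigO_exp_neg (half_pos hl) (by fun_prop) ?_
  have h1 := (isLittleO_pow_exp_pos_mul_atTop M (half_pos hl)).isBigO.comp_tendsto
    (tendsto_atTop_add_const_left atTop (1 : ℝ) tendsto_id)
  have h2 := h1.mul (isBigO_refl (fun y : ℝ => Real.exp (-(lam * y))) atTop)
  -- Half of the exponential absorbs the polynomial in `1 + y`; the shift by `1` costs the constant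
  -- `exp (lam / 2)`.
  refine (h2.trans (IsBigO.of_bound (Real.exp (lam / 2)) (Eventually.of_forall fun y => ?_)))
  simp only [Function.comp_apply, id, ← Real.exp_add, Real.norm_eq_abs, Real.abs_exp]
  exact le_of_eq (by ring_nf)

lemma integrableOn_pow_mul_exp_neg (n : ℕ) (hl : 0 < lam) :
    IntegrableOn (fun y : ℝ => y ^ n * Real.exp (-(lam * y))) (Set.Ioi 0) := by
  refine Integrable.mono' (integrableOn_one_add_pow_mul_exp_neg n hl)
    (Continuous.aestronglyMeasurable (by fun_prop)) ?_
  filter_upwards [ae_restrict_mem measurableSet_Ioi] with y hy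
  have hy : 0 < y := hy
  rw [Real.norm_of_nonneg (by positivity)]
  gcongr
  linarith

lemma integral_pow_mul_exp_neg (n : ℕ) (hl : 0 < lam) :
    ∫ y in Set.Ioi (0 : ℝ), y ^ n * Real.exp (-(lam * y)) = n.factorial / lam ^ (n + 1) := by
  have h := Real.integral_rpow_mul_exp_neg_mul_Ioi (a := n + 1) (by positivity) hl
  simp only [add_sub_cancel_right, Real.rpow_natCast, Real.Gamma_nat_eq_factorial] at h
  rw [h, ← Nat.cast_succ, Real.rpow_natCast, one_div, inv_pow, Nat.succ_eq_add_one]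
  ring

/-- Minus the derivative of `y ^ j * exp (-lam * y)`. -/
noncomputable def expPolyDensity (j : ℕ) (lam y : ℝ) : ℝ :=
  lam * (y ^ j * Real.exp (-(lam * y))) - j * (y ^ (j - 1) * Real.exp (-(lam * y)))

lemma hasDerivAt_neg_pow_mul_exp_neg (j : ℕ) (lam y : ℝ) :
    HasDerivAt (fun y : ℝ => -(y ^ j * Real.exp (-(lam * y)))) (expPolyDensity j lam y) y := by
  have h1 : HasDerivAt (fun y : ℝ => Real.exp (-(lam * y)))
      (Real.exp (-(lam * y)) * -(lam * 1)) y :=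
    (((hasDerivAt_id y).const_mul lam).neg).exp
  refine ((hasDerivAt_pow j y).mul h1).neg.congr_deriv ?_
  rw [expPolyDensity]
  ring

lemma integrableOn_expPolyDensity (j : ℕ) (hl : 0 < lam) :
    IntegrableOn (expPolyDensity j lam) (Set.Ioi 0) :=
  ((integrableOn_pow_mul_exp_neg j hl).const_mul _).sub
    ((integrableOn_pow_mul_exp_neg (j - 1) hl).const_mul _)

lemma integral_Ioi_expPolyDensity (j : ℕ) (hl : 0 < lam) {x : ℝ} (hx : 0 ≤ x) :
    ∫ y in Set.Ioi x, expPolyDensity j lam y = x ^ j * Real.exp (-(lam * x)) := by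
  have ht : Tendsto (fun y : ℝ => -(y ^ j * Real.exp (-(lam * y)))) atTop (𝓝 0) := by
    have h := (isLittleO_pow_exp_pos_mul_atTop j hl).tendsto_div_nhds_zero.neg
    rw [neg_zero] at h
    refine h.congr fun y => ?_
    rw [Real.exp_neg, div_eq_mul_inv]
  rw [integral_Ioi_of_hasDerivAt_of_tendsto' (fun y _ => hasDerivAt_neg_pow_mul_exp_neg j lam y)
    ((integrableOn_expPolyDensity j hl).mono_set (Set.Ioi_subset_Ioi hx)) ht]
  ring

/-- In effect an integration by parts: the value is the integral of `y ^ j * exp (-(lam * y))`. -/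
lemma integral_expPolyDensity_mul_self (j : ℕ) (hl : 0 < lam) :
    ∫ y in Set.Ioi 0, expPolyDensity j lam y * y = j.factorial / lam ^ (j + 1) := by
  have h (y : ℝ) : expPolyDensity j lam y * y =
      lam * (y ^ (j + 1) * Real.exp (-(lam * y))) - j * (y ^ j * Real.exp (-(lam * y))) := by
    rw [expPolyDensity]
    -- For `j = 0` the exponent `j - 1` truncates to `0`, harmlessly since its coefficient is `0`.
    rcases j with _ | j
    · simp; ring
    · rw [Nat.add_sub_cancel]; ring
  simp_rw [h]
  rw [integral_sub ((integrableOn_pow_mul_exp_neg _ hl).const_mul _)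
    ((integrableOn_pow_mul_exp_neg _ hl).const_mul _), integral_const_mul, integral_const_mul,
    integral_pow_mul_exp_neg _ hl, integral_pow_mul_exp_neg _ hl, Nat.factorial_succ]
  push_cast
  field_simp
  ring

lemma abs_expPolyDensity_le (j : ℕ) (hl : 0 < lam) {y : ℝ} (hy : 0 ≤ y) :
    |expPolyDensity j lam y| ≤ (lam + j) * ((1 + y) ^ j * Real.exp (-(lam * y))) := by
  have h1 : y ^ j ≤ (1 + y) ^ j := by gcongr; linarith
  have h2 : y ^ (j - 1) ≤ (1 + y) ^ j :=
    (pow_le_pow_left₀ hy (by linarith) _).trans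
      (pow_le_pow_right₀ (by linarith) (Nat.sub_le _ _))
  rw [expPolyDensity]
  refine (abs_sub _ _).trans ?_
  rw [abs_of_nonneg (by positivity), abs_of_nonneg (by positivity), add_mul]
  gcongr

end ExpPoly

/-! ### Abelian asymptotics of the sums over boxes -/

section MainAsymptotics

variable {p : ℕ → ℝ} {g : ℝ → ℝ}

/-- In the layer cake formula the tail integral of the density contributes `x k ^ j * exp (-(lam * x
k))`, and the mass `x k` supplies the extra power. -/
lemma hasSum_pow_mul_exp_neg {x : ℕ → ℝ} (h0 : ∀ k, 0 ≤ x k) (hx : Summable x) (j : ℕ)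
    {lam : ℝ} (hl : 0 < lam) :
    HasSum (fun k => x k ^ (j + 1) * Real.exp (-(lam * x k)))
      (∫ y in Set.Ioi 0, expPolyDensity j lam y * lowMass x y) := by
  refine (hasSum_mul_integral_Ioi h0 hx (integrableOn_expPolyDensity j hl)).congr_fun fun k => ?_
  rw [integral_Ioi_expPolyDensity j hl (h0 k)]
  ring

/-- If the mass of the small probabilities is `t * g (1 / t)`, up to equivalence, then the mass
`T * p k` at the points `T * p k` is asymptotic to `g T` times Lebesgue measure. -/
theorem tendsto_tsum_pow_mul_exp_neg (h0 : ∀ k, 0 ≤ p k) (hp : Summable p)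
    (hinf : {k | 0 < p k}.Infinite) (hg : IsSlowlyVarying g)
    (hB : lowMass p ~[𝓝[>] 0] fun t : ℝ => t * g (1 / t)) (j : ℕ) {lam : ℝ} (hl : 0 < lam) :
    Tendsto (fun T => (∑' k, (T * p k) ^ (j + 1) * Real.exp (-(lam * (T * p k)))) / g T) atTop
      (𝓝 (j.factorial / lam ^ (j + 1))) := by
  obtain ⟨C, hC⟩ := exists_lowMass_doubling h0 hp hinf hg hB
  obtain ⟨N, hN⟩ := exists_lowMass_mul_le h0 hp hC
  have hm := (monotone_lowMass h0 hp).measurable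
  have hle : ∀ᶠ T in atTop, T * lowMass p (1 / T) / g T ≤ 2 :=
    (tendsto_lowMass_div hg hB one_pos).eventually_le_const one_lt_two
  have key : Tendsto (fun T => ∫ y in Set.Ioi 0,
      expPolyDensity j lam y * (T * lowMass p (y / T) / g T)) atTop
      (𝓝 (∫ y in Set.Ioi 0, expPolyDensity j lam y * y)) := by
    -- The domination is uniform in `T`: doubling bounds the mass at `y / T` by `(2 * (1 + y)) ^ N`
    -- times the mass at `1 / T`, whose normalized value is eventually at most `2`.
    refine tendsto_integral_filter_of_dominated_convergence
      (fun y => (lam + j) * 2 ^ N * 2 * ((1 + y) ^ (j + N) * Real.exp (-(lam * y)))) ?_ ?_ ?_ ?_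
    · refine Eventually.of_forall fun T => AEStronglyMeasurable.mul
        (integrableOn_expPolyDensity j hl).aestronglyMeasurable ?_
      exact (((hm.comp (measurable_id.div_const T)).const_mul T).div_const _).aestronglyMeasurable
    · filter_upwards [hle, eventually_gt_atTop 0, hg.1] with T h2 hT hgT
      filter_upwards [ae_restrict_mem measurableSet_Ioi] with y hy
      have hy : 0 < y := hy
      have hl0 := lowMass_nonneg h0 (y / T)
      rw [norm_mul, Real.norm_eq_abs, Real.norm_of_nonneg (by positivity)]
      have h3 := hN (1 / T) (one_div_pos.2 hT) y hy.le
      rw [mul_one_div] at h3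
      have h4 : T * lowMass p (y / T) / g T ≤ (2 * (1 + y)) ^ N * 2 := by
        calc T * lowMass p (y / T) / g T
            ≤ T * ((2 * (1 + y)) ^ N * lowMass p (1 / T)) / g T := by gcongr
          _ = (2 * (1 + y)) ^ N * (T * lowMass p (1 / T) / g T) := by ring
          _ ≤ _ := by gcongr
      calc _ ≤ (lam + j) * ((1 + y) ^ j * Real.exp (-(lam * y))) * ((2 * (1 + y)) ^ N * 2) := by
            gcongr
            exact abs_expPolyDensity_le j hl hy.le
        _ = _ := by rw [mul_pow, pow_add]; ring
    · exact (integrableOn_one_add_pow_mul_exp_neg _ hl).const_mul _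
    · filter_upwards [ae_restrict_mem measurableSet_Ioi] with y hy
      exact (tendsto_lowMass_div hg hB hy).const_mul _
  rw [integral_expPolyDensity_mul_self j hl] at key
  refine key.congr' ?_
  filter_upwards [eventually_gt_atTop 0] with T hT
  rw [(hasSum_pow_mul_exp_neg (fun k => mul_nonneg hT.le (h0 k)) (hp.mul_left T) j hl).tsum_eq,
    ← integral_div]
  simp_rw [lowMass_const_mul hT, mul_div_assoc]

end MainAsymptotics

/-! ### Poissonization: independence of the boxes -/

lemma integral_pow_poissonMeasure (r : ℝ≥0) (z : ℂ) :
    ∫ n, z ^ n ∂poissonMeasure r = Complex.exp (r * (z - 1)) := by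
  rw [integral_poissonMeasure]
  have h (n : ℕ) : (Real.exp (-r) * r ^ n / n.factorial) • z ^ n =
      Complex.exp (-(r : ℂ)) * ((r * z) ^ n / n.factorial) := by
    rw [Complex.real_smul]
    push_cast
    ring
  simp_rw [h]
  rw [tsum_mul_left, (NormedSpace.expSeries_div_hasSum_exp ((r : ℂ) * z)).tsum_eq,
    ← Complex.exp_eq_exp_ℂ, ← Complex.exp_add]
  ring_nf

section Occupancy

lemma ballCount_eq_sum {Ω : Type*} {ξ : ℕ → Ω → ℕ} (n k : ℕ) (ω : Ω) :
    ballCount ξ n k ω = ∑ i ∈ Finset.range n, if ξ i ω = k then 1 else 0 := by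
  rw [ballCount, Finset.card_filter]

/-- Summation by balls instead of boxes; the contributions of the balls are independent even when
their number is fixed. -/
lemma sum_mul_ballCount {Ω : Type*} {ξ : ℕ → Ω → ℕ} (n : ℕ) (s : Finset ℕ) (t : ℕ → ℝ) (ω : Ω) :
    ∑ k ∈ s, t k * ballCount ξ n k ω =
      ∑ i ∈ Finset.range n, if ξ i ω ∈ s then t (ξ i ω) else 0 := by
  simp_rw [ballCount_eq_sum]
  push_cast
  simp_rw [Finset.mul_sum]
  rw [Finset.sum_comm]
  refine Finset.sum_congr rfl fun i _ => ?_
  simp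

variable {Ω : Type*} [MeasurableSpace Ω] {P : Measure Ω} {p : ℕ → ℝ} {ξ : ℕ → Ω → ℕ}

lemma measurable_ballCount (hξ : ∀ i, Measurable (ξ i)) (n k : ℕ) :
    Measurable (ballCount ξ n k) := by
  rw [show ballCount ξ n k = fun ω => ∑ i ∈ Finset.range n, if ξ i ω = k then 1 else 0 from
    funext (ballCount_eq_sum n k)]
  exact Finset.measurable_fun_sum _ fun i _ =>
    Measurable.ite (hξ i (measurableSet_singleton k)) measurable_const measurable_const

/-- The composition of a countable family of measurable functions with a random index. -/
lemma measurable_randomIndex {E : Type*} [MeasurableSpace E] {N : Ω → ℕ} (hN : Measurable N)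
    {f : ℕ → Ω → E} (hf : ∀ n, Measurable (f n)) : Measurable fun ω => f (N ω) ω :=
  (measurable_from_prod_countable_right (f := fun q : ℕ × Ω => f q.1 q.2) hf).comp
    (hN.prodMk measurable_id)

namespace IsOccupancyScheme

lemma measurable_ballCount_randomIndex (hξ : IsOccupancyScheme p ξ P) {N : Ω → ℕ} (hN : Measurable N)
    (k : ℕ) : Measurable fun ω => ballCount ξ (N ω) k ω :=
  measurable_randomIndex hN fun n => measurable_ballCount hξ.measurable n k

variable [IsProbabilityMeasure P]

lemma identDistrib (hξ : IsOccupancyScheme p ξ P) (i : ℕ) : IdentDistrib (ξ i) (ξ 0) P P := by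
  refine ⟨(hξ.measurable i).aemeasurable, (hξ.measurable 0).aemeasurable, ?_⟩
  refine Measure.ext_of_singleton fun k => ?_
  rw [Measure.map_apply (hξ.measurable i) (measurableSet_singleton k),
    Measure.map_apply (hξ.measurable 0) (measurableSet_singleton k),
    ← ENNReal.toReal_eq_toReal_iff' (measure_ne_top _ _) (measure_ne_top _ _)]
  exact (hξ.law i k).trans (hξ.law 0 k).symm

lemma integral_exp_sum (hξ : IsOccupancyScheme p ξ P) (τ : ℕ → ℝ) (n : ℕ) :
    ∫ ω, Complex.exp ((∑ i ∈ Finset.range n, τ (ξ i ω) : ℝ) * Complex.I) ∂P =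
      (∫ ω, Complex.exp (τ (ξ 0 ω) * Complex.I) ∂P) ^ n := by
  have hm (i : ℕ) : Measurable fun ω => τ (ξ i ω) :=
    (measurable_from_nat (f := τ)).comp (hξ.measurable i)
  have hc {X : Ω → ℝ} (hX : Measurable X) :
      charFun (P.map X) 1 = ∫ ω, Complex.exp (X ω * Complex.I) ∂P := by
    rw [charFun_apply_real, integral_map hX.aemeasurable (by fun_prop)]
    simp
  have hind : iIndepFun (fun i ω => τ (ξ i ω)) P :=
    hξ.indep.comp (fun _ => τ) fun _ => measurable_from_nat
  rw [← hc (Finset.measurable_fun_sum _ fun i _ => hm i),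
    iIndepFun.charFun_map_fun_finsetSum_eq_prod (fun i _ => (hm i).aemeasurable)
      (hind.restrict _), Finset.prod_apply]
  rw [Finset.prod_congr rfl (g := fun _ => ∫ ω, Complex.exp (τ (ξ 0 ω) * Complex.I) ∂P)]
  · simp
  · intro i _
    rw [← hc (hm 0)]
    congr 1
    exact ((hξ.identDistrib i).comp (u := τ) measurable_from_nat).map_eq

/-- A single ball hits at most one box of `s`, so the exponential minus `1` is a sum of disjoint
indicators. -/
lemma integral_exp_indicator (hξ : IsOccupancyScheme p ξ P) (s : Finset ℕ) (t : ℕ → ℝ) :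
    ∫ ω, Complex.exp ((if ξ 0 ω ∈ s then t (ξ 0 ω) else 0 : ℝ) * Complex.I) ∂P =
      1 + ∑ k ∈ s, p k * (Complex.exp (t k * Complex.I) - 1) := by
  have h (ω : Ω) : Complex.exp ((if ξ 0 ω ∈ s then t (ξ 0 ω) else 0 : ℝ) * Complex.I) =
      1 + ∑ k ∈ s, {ω | ξ 0 ω = k}.indicator
        (fun _ => Complex.exp (t k * Complex.I) - 1) ω := by
    simp only [Set.indicator_apply, Set.mem_ofPred_eq]
    rw [Finset.sum_ite_eq]
    split_ifs <;> simp
  have hms (k : ℕ) : MeasurableSet {ω | ξ 0 ω = k} :=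
    hξ.measurable 0 (measurableSet_singleton k)
  have hint (k : ℕ) : Integrable ({ω | ξ 0 ω = k}.indicator
      (fun _ => Complex.exp (t k * Complex.I) - 1)) P :=
    (integrable_const _).indicator (hms k)
  simp_rw [h]
  rw [integral_add (integrable_const _) (integrable_finsetSum _ fun k _ => hint k),
    integral_finsetSum _ fun k _ => hint k]
  simp_rw [integral_indicator_const _ (hms _), hξ.law]
  simp

variable {N : Ω → ℕ} {r : ℝ≥0}

/-- The joint characteristic function of the occupancy numbers of finitely many boxes, when the
number of balls is Poisson distributed. -/
lemma integral_exp_sum_ballCount (hξ : IsOccupancyScheme p ξ P) (hN : Measurable N)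
    (hNlaw : HasLaw N (poissonMeasure r) P)
    (hind : IndepFun N (fun ω i => ξ i ω) P) (s : Finset ℕ) (t : ℕ → ℝ) :
    ∫ ω, Complex.exp ((∑ k ∈ s, t k * ballCount ξ (N ω) k ω : ℝ) * Complex.I) ∂P =
      ∏ k ∈ s, Complex.exp (r * p k * (Complex.exp (t k * Complex.I) - 1)) := by
  let τ (m : ℕ) : ℝ := if m ∈ s then t m else 0
  let F (q : ℕ × (ℕ → ℕ)) : ℂ :=
    Complex.exp ((∑ i ∈ Finset.range q.1, τ (q.2 i) : ℝ) * Complex.I)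
  have hξm : Measurable fun ω i => ξ i ω := measurable_pi_iff.2 hξ.measurable
  have hF : Measurable F := measurable_from_prod_countable_right fun n => by
    have : Measurable fun x : ℕ → ℕ => ∑ i ∈ Finset.range n, τ (x i) :=
      Finset.measurable_fun_sum _ fun i _ =>
        (measurable_from_nat (f := τ)).comp (measurable_pi_apply i)
    exact Complex.measurable_exp.comp
      ((Complex.measurable_ofReal.comp this).mul_const Complex.I)
  have hFn (q : ℕ × (ℕ → ℕ)) : ‖F q‖ = 1 := Complex.norm_exp_ofReal_mul_I _
  have h1 : ∫ ω, Complex.exp ((∑ k ∈ s, t k * ballCount ξ (N ω) k ω : ℝ) * Complex.I) ∂P =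
      ∫ q, F q ∂(P.map fun ω => (N ω, fun i => ξ i ω)) := by
    rw [integral_map (hN.prodMk hξm).aemeasurable hF.aestronglyMeasurable]
    simp_rw [sum_mul_ballCount]
    rfl
  have : IsProbabilityMeasure (P.map fun ω i => ξ i ω) :=
    Measure.isProbabilityMeasure_map hξm.aemeasurable
  rw [h1, hind.map_prod_eq_prod_map_map hN.aemeasurable hξm.aemeasurable, hNlaw.map_eq,
    integral_prod _ (Integrable.of_bound hF.aestronglyMeasurable 1
      (Eventually.of_forall fun q => (hFn q).le))]
  have h2 (n : ℕ) : ∫ x, F (n, x) ∂(P.map fun ω i => ξ i ω) =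
      (1 + ∑ k ∈ s, p k * (Complex.exp (t k * Complex.I) - 1)) ^ n := by
    rw [integral_map (f := fun x => F (n, x)) hξm.aemeasurable
      (hF.comp measurable_prodMk_left).aestronglyMeasurable, ← hξ.integral_exp_indicator s t]
    exact hξ.integral_exp_sum τ n
  simp_rw [h2]
  -- The Poisson generating function turns the sum over boxes into an exponent, hence into a product
  -- over boxes.
  rw [integral_pow_poissonMeasure, ← Complex.exp_sum, add_sub_cancel_left, Finset.mul_sum]
  simp_rw [mul_assoc]

lemma hasLaw_ballCount (hp : ∀ k, 0 ≤ p k) (hξ : IsOccupancyScheme p ξ P) (hN : Measurable N)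
    (hNlaw : HasLaw N (poissonMeasure r) P)
    (hind : IndepFun N (fun ω i => ξ i ω) P) (k : ℕ) :
    HasLaw (fun ω => ballCount ξ (N ω) k ω) (poissonMeasure (r * (p k).toNNReal)) P := by
  have hm := hξ.measurable_ballCount_randomIndex hN k
  refine ⟨hm.aemeasurable, ?_⟩
  -- Laws on `ℕ` are compared after embedding into `ℝ`, where the characteristic function determines
  -- them.
  apply (MeasurableEmbedding.natCast (α := ℝ)).map_injective
  have := Measure.isProbabilityMeasure_map (μ := P) hm.aemeasurable
  have := Measure.isProbabilityMeasure_map (μ := P.map fun ω => ballCount ξ (N ω) k ω)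
    (f := (Nat.cast : ℕ → ℝ)) measurable_from_nat.aemeasurable
  apply Measure.ext_of_charFun
  ext t
  rw [charFun_map_cast_poissonMeasure, charFun_apply_real,
    integral_map measurable_from_nat.aemeasurable (by fun_prop),
    integral_map hm.aemeasurable measurable_from_nat.aestronglyMeasurable]
  have h := hξ.integral_exp_sum_ballCount hN hNlaw hind {k} fun _ => t
  simp only [Finset.sum_singleton, Finset.prod_singleton] at h
  push_cast at h ⊢
  rw [h]
  congr 3
  exact_mod_cast congrArg (Complex.ofReal) (Real.coe_toNNReal _ (hp k)).symm

/-- Poissonization: the occupancy numbers of the boxes are independent. -/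
lemma iIndepFun_ballCount (hξ : IsOccupancyScheme p ξ P) (hN : Measurable N)
    (hNlaw : HasLaw N (poissonMeasure r) P)
    (hind : IndepFun N (fun ω i => ξ i ω) P) :
    iIndepFun (fun k ω => ballCount ξ (N ω) k ω) P := by
  let W (ω : Ω) (k : ℕ) : ℝ := ballCount ξ (N ω) k ω
  have hm (k : ℕ) : Measurable fun ω => W ω k :=
    measurable_from_nat.comp (hξ.measurable_ballCount_randomIndex hN k)
  have hW : Measurable W := measurable_pi_iff.2 hm
  -- Independence is proved for the real-valued counts by factoring characteristic functions, then
  -- carried back to `ℕ` by the floor.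
  suffices h : iIndepFun (fun k ω => W ω k) P by
    have := h.comp (fun _ => Nat.floor) fun _ => Nat.measurable_floor
    simpa [W, Function.comp_def] using this
  rw [iIndepFun_iff_finset]
  intro s
  classical
  refine (iIndepFun_iff_charFun_pi (X := s.restrict fun k ω => W ω k) fun k => (hm k).aemeasurable).2 fun t => ?_
  have h1 := charFun_map_euclideanRestrict hW.aemeasurable (Q := P) s t
  rw [Measure.map_map (measurable_euclideanRestrict s) hW] at h1
  refine h1.trans ?_
  rw [hξ.integral_exp_sum_ballCount hN hNlaw hind, ← Finset.prod_coe_sort s]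
  refine Finset.prod_congr rfl fun k _ => ?_
  have h2 := hξ.integral_exp_sum_ballCount hN hNlaw hind {(k : ℕ)} fun _ => t k
  simp only [Finset.sum_singleton, Finset.prod_singleton] at h2
  change _ = charFun (P.map fun ω => W ω k) (t k)
  rw [charFun_apply_real, integral_map (hm k).aemeasurable (by fun_prop)]
  simp only [Finset.coe_mem, dif_pos, Subtype.coe_eta]
  rw [← h2]
  simp [W]

end IsOccupancyScheme

end Occupancy

/-! ### Quantitative central limit theorem -/

lemma norm_prod_sub_prod_le_sum_norm_sub {ι : Type*} (s : Finset ι) {a b : ι → ℂ}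
    (ha : ∀ i, ‖a i‖ ≤ 1) (hb : ∀ i, ‖b i‖ ≤ 1) :
    ‖∏ i ∈ s, a i - ∏ i ∈ s, b i‖ ≤ ∑ i ∈ s, ‖a i - b i‖ := by
  classical
  induction s using Finset.induction_on with
  | empty => simp
  | insert i s his ih =>
    rw [Finset.prod_insert his, Finset.prod_insert his, Finset.sum_insert his]
    have hpb : ‖∏ j ∈ s, b j‖ ≤ 1 := by
      rw [norm_prod]
      exact Finset.prod_le_one (fun j _ => norm_nonneg _) fun j _ => hb j
    calc ‖a i * ∏ j ∈ s, a j - b i * ∏ j ∈ s, b j‖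
        = ‖(a i - b i) * ∏ j ∈ s, b j + a i * (∏ j ∈ s, a j - ∏ j ∈ s, b j)‖ := by ring_nf
      _ ≤ ‖a i - b i‖ * ‖∏ j ∈ s, b j‖ + ‖a i‖ * ‖∏ j ∈ s, a j - ∏ j ∈ s, b j‖ := by
        refine (norm_add_le _ _).trans ?_
        rw [norm_mul, norm_mul]
      _ ≤ ‖a i - b i‖ * 1 + 1 * ∑ j ∈ s, ‖a j - b j‖ := by
        gcongr
        exact ha i
      _ = _ := by ring

section CharFunEstimate

variable {Ω : Type*} [MeasurableSpace Ω] {P : Measure Ω} [IsProbabilityMeasure P]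

lemma integrable_of_abs_le {X : Ω → ℝ} (hX : Measurable X) {ε : ℝ} (hb : ∀ ω, |X ω| ≤ ε) :
    Integrable X P :=
  Integrable.of_bound hX.aestronglyMeasurable ε (Eventually.of_forall hb)

lemma integrable_sq_of_abs_le {X : Ω → ℝ} (hX : Measurable X) {ε : ℝ} (hb : ∀ ω, |X ω| ≤ ε) :
    Integrable (fun ω => X ω ^ 2) P :=
  integrable_of_abs_le (hX.pow_const 2) (ε := ε ^ 2) fun ω => by
    rw [abs_pow]
    exact pow_le_pow_left₀ (abs_nonneg _) (hb ω) 2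

/-- Both terms are compared with `1 - v / 2`, where `v` is the second moment: centering removes the
linear Taylor term, and smallness reduces the third moment to `ε * v`. -/
lemma norm_integral_exp_sub_exp_le {X : Ω → ℝ} (hX : Measurable X) {ε : ℝ} (hε : ε ≤ 1)
    (hb : ∀ ω, |X ω| ≤ ε) (h0 : ∫ ω, X ω ∂P = 0) :
    ‖∫ ω, Complex.exp (X ω * Complex.I) ∂P
      - Complex.exp ((-((∫ ω, X ω ^ 2 ∂P) / 2) : ℝ))‖ ≤ ε * ∫ ω, X ω ^ 2 ∂P := by
  have hε0 : 0 ≤ ε := by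
    obtain ⟨ω⟩ := P.nonempty_of_neZero
    exact (abs_nonneg _).trans (hb ω)
  have hi1 := integrable_of_abs_le (P := P) hX hb
  have hi2 := integrable_sq_of_abs_le (P := P) hX hb
  have hie : Integrable (fun ω => Complex.exp (X ω * Complex.I)) P :=
    Integrable.of_bound (Complex.measurable_exp.comp
      ((Complex.measurable_ofReal.comp hX).mul_const _)).aestronglyMeasurable 1
      (Eventually.of_forall fun ω => (Complex.norm_exp_ofReal_mul_I _).le)
  set v := ∫ ω, X ω ^ 2 ∂P with hv
  have hv0 : 0 ≤ v := integral_nonneg fun ω => sq_nonneg _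
  have hvε : v ≤ ε ^ 2 := by
    calc v ≤ ∫ _, ε ^ 2 ∂P := integral_mono hi2 (integrable_const _) fun ω => by
          simp only
          rw [← sq_abs]
          exact pow_le_pow_left₀ (abs_nonneg _) (hb ω) 2
      _ = ε ^ 2 := by simp
  -- The factor `2 / 9` is `4 / (3! * 3)`, from the remainder bound of the exponential series after
  -- three terms.
  have hpt (ω : Ω) : ‖Complex.exp (X ω * Complex.I) - (1 + X ω * Complex.I - (X ω ^ 2 : ℝ) / 2)‖
      ≤ ε * X ω ^ 2 * (2 / 9) := by
    have hn : ‖(X ω : ℂ) * Complex.I‖ = |X ω| := by simp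
    have h := Complex.exp_bound (x := X ω * Complex.I) (hn.le.trans ((hb ω).trans hε))
      (n := 3) (by norm_num)
    rw [hn] at h
    have h3 : ∑ m ∈ Finset.range 3, ((X ω : ℂ) * Complex.I) ^ m / m.factorial =
        1 + X ω * Complex.I - (X ω ^ 2 : ℝ) / 2 := by
      simp [Finset.sum_range_succ, mul_pow, Complex.I_sq, Nat.factorial]
      ring
    rw [h3] at h
    refine h.trans ?_
    have h4 : |X ω| ^ 3 ≤ ε * X ω ^ 2 := by
      rw [pow_succ', sq_abs]
      exact mul_le_mul_of_nonneg_right (hb ω) (sq_nonneg _)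
    norm_num [Nat.factorial]
    linarith
  have hiq : Integrable (fun ω => 1 + X ω * Complex.I - (X ω ^ 2 : ℝ) / 2 : Ω → ℂ) P :=
    ((integrable_const _).add (hi1.ofReal.mul_const _)).sub (hi2.ofReal.div_const _)
  have h1 : ‖∫ ω, Complex.exp (X ω * Complex.I) ∂P - (1 - v / 2)‖ ≤ ε * v * (2 / 9) := by
    have : ∫ ω, (1 + X ω * Complex.I - (X ω ^ 2 : ℝ) / 2 : ℂ) ∂P = 1 - v / 2 := by
      rw [integral_sub ((integrable_const _).add (hi1.ofReal.mul_const _))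
        (hi2.ofReal.div_const _), integral_add (integrable_const _) (hi1.ofReal.mul_const _),
        integral_mul_const, integral_div, integral_complex_ofReal, integral_complex_ofReal, h0, hv]
      simp
    rw [← this, ← integral_sub hie hiq]
    refine (norm_integral_le_of_norm_le ((hi2.const_mul ε).mul_const (2 / 9))
      (Eventually.of_forall hpt)).trans ?_
    rw [integral_mul_const, integral_const_mul]
  -- The remainder after two terms is at most `3 / 4 * (v / 2) ^ 2`, and `v ≤ ε ^ 2 ≤ ε`.
  have h2 : |Real.exp (-(v / 2)) - (1 - v / 2)| ≤ ε * v * (3 / 16) := by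
    have hle : ε ^ 2 ≤ ε := by nlinarith
    have hv2 : 0 ≤ v / 2 := by positivity
    have h := Real.exp_bound (x := -(v / 2)) (by rw [abs_neg, abs_of_nonneg hv2]; linarith)
      (n := 2) (by norm_num)
    rw [abs_neg, abs_of_nonneg hv2, show ∑ m ∈ Finset.range 2, (-(v / 2)) ^ m / m.factorial
      = 1 - v / 2 by simp [Finset.sum_range_succ]; ring] at h
    refine h.trans ?_
    norm_num [Nat.factorial]
    nlinarith
  have h3 : ‖Complex.exp ((-(v / 2) : ℝ)) - (1 - v / 2)‖ ≤ ε * v * (3 / 16) := by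
    rw [← Complex.ofReal_exp, show ((1 : ℂ) - v / 2) = ((1 - v / 2 : ℝ) : ℂ) by push_cast; rfl,
      ← Complex.ofReal_sub, Complex.norm_real]
    exact h2
  calc _ = ‖(∫ ω, Complex.exp (X ω * Complex.I) ∂P - (1 - v / 2))
        - (Complex.exp ((-(v / 2) : ℝ)) - (1 - v / 2))‖ := by
        rw [sub_sub_sub_cancel_right]
    _ ≤ ε * v * (2 / 9) + ε * v * (3 / 16) := (norm_sub_le _ _).trans (add_le_add h1 h3)
    _ ≤ ε * v := by nlinarith [mul_nonneg hε0 hv0]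

/-- Quantitative central limit theorem for characteristic functions of finite sums of uniformly
small independent random variables. -/
lemma norm_integral_exp_sum_sub_exp_le {X : ℕ → Ω → ℝ} (hX : ∀ k, Measurable (X k))
    (hind : iIndepFun X P) {ε : ℝ} (hε : ε ≤ 1) (hb : ∀ k ω, |X k ω| ≤ ε)
    (h0 : ∀ k, ∫ ω, X k ω ∂P = 0) (s : Finset ℕ) :
    ‖∫ ω, Complex.exp ((∑ k ∈ s, X k ω : ℝ) * Complex.I) ∂P
      - Complex.exp ((-((∑ k ∈ s, ∫ ω, X k ω ^ 2 ∂P) / 2) : ℝ))‖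
      ≤ ε * ∑ k ∈ s, ∫ ω, X k ω ^ 2 ∂P := by
  have hc {X : Ω → ℝ} (hX : Measurable X) :
      ∫ ω, Complex.exp (X ω * Complex.I) ∂P = charFun (P.map X) 1 := by
    rw [charFun_apply_real, integral_map hX.aemeasurable (by fun_prop)]
    simp
  have h1 : ∫ ω, Complex.exp ((∑ k ∈ s, X k ω : ℝ) * Complex.I) ∂P =
      ∏ k ∈ s, ∫ ω, Complex.exp (X k ω * Complex.I) ∂P := by
    rw [hc (Finset.measurable_fun_sum _ fun i _ => hX i),
      iIndepFun.charFun_map_fun_finsetSum_eq_prod (fun i _ => (hX i).aemeasurable)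
        (hind.restrict _), Finset.prod_apply]
    exact Finset.prod_congr rfl fun k _ => (hc (hX k)).symm
  have h2 : Complex.exp ((-((∑ k ∈ s, ∫ ω, X k ω ^ 2 ∂P) / 2) : ℝ)) =
      ∏ k ∈ s, Complex.exp ((-((∫ ω, X k ω ^ 2 ∂P) / 2) : ℝ)) := by
    rw [← Complex.exp_sum, ← Complex.ofReal_sum, Finset.sum_neg_distrib, Finset.sum_div]
  rw [h1, h2, Finset.mul_sum]
  refine (norm_prod_sub_prod_le_sum_norm_sub s (fun k => ?_) fun k => ?_).trans
    (Finset.sum_le_sum fun k _ => norm_integral_exp_sub_exp_le (hX k) hε (hb k) (h0 k))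
  · refine (norm_integral_le_of_norm_le_const (C := 1) (Eventually.of_forall fun ω =>
      (Complex.norm_exp_ofReal_mul_I _).le)).trans ?_
    simp
  · rw [← Complex.ofReal_exp, Complex.norm_real, Real.norm_of_nonneg (Real.exp_nonneg _),
      Real.exp_le_one_iff, neg_nonpos]
    exact div_nonneg (integral_nonneg fun ω => sq_nonneg _) two_pos.le

/-- Quantitative central limit theorem for characteristic functions of series of uniformly small
independent random variables. -/
lemma norm_integral_exp_hasSum_sub_exp_le {X : ℕ → Ω → ℝ} (hX : ∀ k, Measurable (X k))
    (hind : iIndepFun X P) {ε : ℝ} (hε : ε ≤ 1) (hb : ∀ k ω, |X k ω| ≤ ε)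
    (h0 : ∀ k, ∫ ω, X k ω ∂P = 0) {S : Ω → ℝ} (hS : ∀ ω, HasSum (fun k => X k ω) (S ω))
    {V : ℝ} (hV : HasSum (fun k => ∫ ω, X k ω ^ 2 ∂P) V) :
    ‖∫ ω, Complex.exp (S ω * Complex.I) ∂P - Complex.exp ((-(V / 2) : ℝ))‖ ≤ ε * V := by
  have hlim : Tendsto (fun n => ∫ ω, Complex.exp
      ((∑ k ∈ Finset.range n, X k ω : ℝ) * Complex.I) ∂P) atTop
      (𝓝 (∫ ω, Complex.exp (S ω * Complex.I) ∂P)) := by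
    refine tendsto_integral_of_dominated_convergence (fun _ => 1) (fun n => ?_)
      (integrable_const _) (fun n => Eventually.of_forall fun ω =>
        (Complex.norm_exp_ofReal_mul_I _).le) (Eventually.of_forall fun ω => ?_)
    · exact (Complex.measurable_exp.comp ((Complex.measurable_ofReal.comp
        (Finset.measurable_fun_sum _ fun k _ => hX k)).mul_const _)).aestronglyMeasurable
    · exact (Complex.continuous_exp.comp (Complex.continuous_ofReal.mul_const _)).continuousAt.tendsto.comp
        (hS ω).tendsto_sum_nat
  have hV' := hV.tendsto_sum_nat
  have hexp : Tendsto (fun n => Complex.exp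
      ((-((∑ k ∈ Finset.range n, ∫ ω, X k ω ^ 2 ∂P) / 2) : ℝ))) atTop
      (𝓝 (Complex.exp ((-(V / 2) : ℝ)))) :=
    (Complex.continuous_exp.comp Complex.continuous_ofReal).continuousAt.tendsto.comp
      (hV'.div_const 2).neg
  exact le_of_tendsto_of_tendsto' (hlim.sub hexp).norm (hV'.const_mul ε) fun n =>
    norm_integral_exp_sum_sub_exp_le hX hind hε hb h0 _

end CharFunEstimate

/-! ### Poisson weights and box indicators -/

/-- The Poisson probabilities. -/
noncomputable def poissonWeight (l : ℕ) (x : ℝ) : ℝ := Real.exp (-x) * x ^ l / l.factorial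

/-- The covariance of the indicators that a Poisson random variable of mean `x` takes the values
`l` and `m`. -/
noncomputable def poissonCov (l m : ℕ) (x : ℝ) : ℝ :=
  (if l = m then poissonWeight l x else 0) - poissonWeight l x * poissonWeight m x

lemma integrable_natCast_poissonMeasure (r : ℝ≥0) :
    Integrable (fun n : ℕ => (n : ℝ)) (poissonMeasure r) := by
  -- After the shift, `n + 1` times the weight of `n + 1` is `r` times the weight of `n`.
  rw [integrable_poissonMeasure_iff, ← summable_nat_add_iff 1]
  refine ((hasSum_one_poissonMeasure r).summable.mul_left (r : ℝ)).congr fun n => ?_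
  rw [Real.norm_natCast, Nat.factorial_succ]
  push_cast
  field_simp
  ring

/-- The indicator of the event that box `k` contains `l` of the first `n` balls. -/
noncomputable def boxIndicator {Ω : Type*} (ξ : ℕ → Ω → ℕ) (n k l : ℕ) (ω : Ω) : ℝ :=
  if ballCount ξ n k ω = l then 1 else 0

lemma ballCount_eq_zero {Ω : Type*} {ξ : ℕ → Ω → ℕ} {n k : ℕ} {ω : Ω}
    (h : k ∉ (Finset.range n).image fun i => ξ i ω) : ballCount ξ n k ω = 0 := by
  rw [ballCount, Finset.card_eq_zero, Finset.filter_eq_empty_iff]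
  exact fun i hi hk => h (Finset.mem_image.2 ⟨i, hi, hk⟩)

/-- As `l` is positive, a counted box has been hit, so the set is finite and `ncard` does not take
its default value. -/
lemma smallCount_eq_card {Ω : Type*} (ξ : ℕ → Ω → ℕ) (n : ℕ) (l : ℕ+) (ω : Ω) :
    smallCount ξ n l ω = (((Finset.range n).image fun i => ξ i ω).filter
      fun k => ballCount ξ n k ω = l).card := by
  rw [smallCount, ← Set.ncard_coe_finset]
  congr 1
  ext k
  simp only [Set.mem_ofPred_eq, Finset.coe_filter]
  refine ⟨fun h => ⟨?_, h⟩, fun h => h.2⟩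
  by_contra hk
  exact l.pos.ne' (h.symm.trans (ballCount_eq_zero hk))

lemma smallCount_le {Ω : Type*} (ξ : ℕ → Ω → ℕ) (n : ℕ) (l : ℕ+) (ω : Ω) :
    smallCount ξ n l ω ≤ n := by
  rw [smallCount_eq_card]
  exact ((Finset.card_filter_le _ _).trans Finset.card_image_le).trans (Finset.card_range n).le

lemma hasSum_boxIndicator {Ω : Type*} (ξ : ℕ → Ω → ℕ) (n : ℕ) (l : ℕ+) (ω : Ω) :
    HasSum (fun k => boxIndicator ξ n k l ω) (smallCount ξ n l ω : ℝ) := by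
  have h : (smallCount ξ n l ω : ℝ) =
      ∑ k ∈ (Finset.range n).image (fun i => ξ i ω), boxIndicator ξ n k l ω := by
    rw [smallCount_eq_card]
    simp [boxIndicator]
  rw [h]
  refine hasSum_sum_of_ne_finset_zero fun k hk => ?_
  rw [boxIndicator, ballCount_eq_zero hk, if_neg l.pos.ne]

lemma boxIndicator_nonneg {Ω : Type*} (ξ : ℕ → Ω → ℕ) (n k l : ℕ) (ω : Ω) :
    0 ≤ boxIndicator ξ n k l ω := by
  rw [boxIndicator]; split_ifs <;> norm_num

lemma boxIndicator_le_one {Ω : Type*} (ξ : ℕ → Ω → ℕ) (n k l : ℕ) (ω : Ω) :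
    boxIndicator ξ n k l ω ≤ 1 := by
  rw [boxIndicator]; split_ifs <;> norm_num

lemma boxIndicator_mul {Ω : Type*} (ξ : ℕ → Ω → ℕ) (n k l m : ℕ) (ω : Ω) :
    boxIndicator ξ n k l ω * boxIndicator ξ n k m ω =
      if l = m then boxIndicator ξ n k l ω else 0 := by
  simp only [boxIndicator]
  split_ifs <;> simp_all

lemma summable_poissonWeight {x : ℕ → ℝ} (h0 : ∀ k, 0 ≤ x k) (hx : Summable x) (l : ℕ+) :
    Summable fun k => poissonWeight l (x k) := by
  have h := (hasSum_pow_mul_exp_neg h0 hx (l - 1) one_pos).summable.div_const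
    ((l : ℕ).factorial : ℝ)
  refine h.congr fun k => ?_
  rw [Nat.sub_add_cancel l.pos, one_mul, poissonWeight]
  ring

/-- The exponent is written to fit `x ^ (j + 1) * exp (-(lam * x))` with `j = l + m - 1` and `lam =
2`. -/
lemma poissonWeight_mul (l m : ℕ+) (x : ℝ) :
    poissonWeight l x * poissonWeight m x =
      x ^ ((l + m - 1 : ℕ) + 1) * Real.exp (-(2 * x)) /
        ((l : ℕ).factorial * (m : ℕ).factorial) := by
  have := l.pos
  rw [Nat.sub_add_cancel (by omega), poissonWeight, poissonWeight, pow_add, two_mul, neg_add,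
    Real.exp_add]
  ring

lemma summable_poissonCov {x : ℕ → ℝ} (h0 : ∀ k, 0 ≤ x k) (hx : Summable x) (l m : ℕ+) :
    Summable fun k => poissonCov l m (x k) := by
  refine Summable.sub ?_ ?_
  · split_ifs
    · exact summable_poissonWeight h0 hx l
    · exact summable_zero
  · simp_rw [poissonWeight_mul]
    exact (hasSum_pow_mul_exp_neg h0 hx _ two_pos).summable.div_const _

/-- The covariance of the limit process. -/
noncomputable def limitCov (l m : ℕ+) : ℝ :=
  (if l = m then 1 / (l : ℝ) else 0) -
    1 / (((l : ℝ) + (m : ℝ)) * 2 ^ ((l : ℕ) + (m : ℕ))) * (Nat.choose (l + m) l : ℝ)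

lemma limitCov_comm (l m : ℕ+) : limitCov l m = limitCov m l := by
  rw [limitCov, limitCov, Nat.choose_symm_add, add_comm (l : ℕ) m, add_comm (l : ℝ) m]
  congr 1
  rcases eq_or_ne l m with rfl | h
  · rfl
  · rw [if_neg h, if_neg h.symm]

/-! ### Limit of the covariances -/

section Asymptotic

variable {p : ℕ → ℝ} {g : ℝ → ℝ}

/-- The diagonal part uses `j = l - 1`, `lam = 1` and yields `(l - 1)! / l! = 1 / l`. The product
part uses `j = l + m - 1`, `lam = 2` and yields `(l + m - 1)! / (2 ^ (l + m) * l! * m!)`. -/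
lemma tendsto_tsum_poissonCov (hp : IsBoxDistribution p) (hg : IsSlowlyVarying g)
    (hB : lowMass p ~[𝓝[>] 0] fun t : ℝ => t * g (1 / t)) (l m : ℕ+) :
    Tendsto (fun T => (∑' k, poissonCov l m (T * p k)) / g T) atTop (𝓝 (limitCov l m)) := by
  have hlim (j : ℕ) {lam : ℝ} (hl : 0 < lam) :=
    tendsto_tsum_pow_mul_exp_neg hp.nonneg hp.hasSum.summable hp.infinite hg hB j hl
  have h1 : Tendsto (fun T => (∑' k, if l = m then poissonWeight l (T * p k) else 0) / g T) atTop
      (𝓝 (if l = m then 1 / (l : ℝ) else 0)) := by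
    split_ifs with h
    · have h2 := (hlim (l - 1) one_pos).div_const ((l : ℕ).factorial : ℝ)
      have hc : ((l - 1 : ℕ).factorial : ℝ) / 1 ^ ((l - 1 : ℕ) + 1) / (l : ℕ).factorial
          = 1 / (l : ℝ) := by
        have := Nat.mul_factorial_pred l.pos.ne'
        rw [← this]
        have hl := l.pos
        push_cast
        field_simp
        simp
      rw [hc] at h2
      refine h2.congr fun T => ?_
      rw [div_right_comm, ← tsum_div_const]
      congr 2 with k
      rw [Nat.sub_add_cancel l.pos, one_mul, poissonWeight]
      ring
    · simp
  have h2 : Tendsto (fun T => (∑' k, poissonWeight l (T * p k) * poissonWeight m (T * p k)) / g T)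
      atTop (𝓝 (1 / (((l : ℝ) + (m : ℝ)) * 2 ^ ((l : ℕ) + (m : ℕ))) *
        (Nat.choose (l + m) l : ℝ))) := by
    have h3 := (hlim (l + m - 1) two_pos).div_const
      (((l : ℕ).factorial : ℝ) * (m : ℕ).factorial)
    have hc : ((l + m - 1 : ℕ).factorial : ℝ) / 2 ^ ((l + m - 1 : ℕ) + 1) /
        ((l : ℕ).factorial * (m : ℕ).factorial) =
        1 / (((l : ℝ) + (m : ℝ)) * 2 ^ ((l : ℕ) + (m : ℕ))) * (Nat.choose (l + m) l : ℝ) := by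
      have hlm : 0 < (l + m : ℕ) := Nat.add_pos_left l.pos _
      rw [Nat.sub_add_cancel hlm, Nat.choose_symm_add, Nat.add_choose, Nat.cast_div
        (Nat.factorial_mul_factorial_dvd_factorial_add _ _) (by positivity),
        ← Nat.mul_factorial_pred hlm.ne']
      push_cast
      have : ((l : ℝ) + (m : ℝ)) ≠ 0 := by exact_mod_cast hlm.ne'
      field_simp
    rw [hc] at h3
    refine h3.congr fun T => ?_
    rw [div_right_comm, ← tsum_div_const]
    simp_rw [poissonWeight_mul]
  refine (h1.sub h2).congr' ?_
  filter_upwards [eventually_ge_atTop 0] with T hT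
  have h0 (k : ℕ) : 0 ≤ T * p k := mul_nonneg hT (hp.nonneg k)
  have hs := hp.hasSum.summable.mul_left T
  rw [← sub_div, ← Summable.tsum_sub]
  · simp_rw [poissonCov, PNat.coe_inj]
  · split_ifs
    · exact summable_poissonWeight h0 hs l
    · exact summable_zero
  · simp_rw [poissonWeight_mul]
    exact (hasSum_pow_mul_exp_neg h0 hs _ two_pos).summable.div_const _

end Asymptotic

/-! ### Moments of the counts -/

section Moments

variable {Ω : Type*} [MeasurableSpace Ω] {P : Measure Ω} {p : ℕ → ℝ} {ξ : ℕ → Ω → ℕ}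
  {N : Ω → ℕ} {r : ℝ≥0}

namespace IsOccupancyScheme

lemma measurable_boxIndicator (hξ : IsOccupancyScheme p ξ P) (hN : Measurable N) (k l : ℕ) :
    Measurable fun ω => boxIndicator ξ (N ω) k l ω :=
  Measurable.ite (hξ.measurable_ballCount_randomIndex hN k (measurableSet_singleton l))
    measurable_const measurable_const

lemma measurable_smallCount (hξ : IsOccupancyScheme p ξ P) (hN : Measurable N) (l : ℕ+) :
    Measurable fun ω => (smallCount ξ (N ω) l ω : ℝ) :=
  measurable_of_tendsto_metrizable
    (fun n => Finset.measurable_fun_sum (Finset.range n) fun k _ =>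
      hξ.measurable_boxIndicator hN k l)
    (tendsto_pi_nhds.2 fun ω => (hasSum_boxIndicator ξ (N ω) l ω).tendsto_sum_nat)

lemma integrable_smallCount (hξ : IsOccupancyScheme p ξ P) (hN : Measurable N)
    (hNlaw : HasLaw N (poissonMeasure r) P) (l : ℕ+) :
    Integrable (fun ω => (smallCount ξ (N ω) l ω : ℝ)) P := by
  have hi : Integrable (fun ω => (N ω : ℝ)) P := by
    have h := integrable_natCast_poissonMeasure r
    rw [← hNlaw.map_eq] at h
    exact h.comp_measurable hN
  refine hi.mono' (hξ.measurable_smallCount hN l).aestronglyMeasurable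
    (Eventually.of_forall fun ω => ?_)
  rw [Real.norm_natCast]
  exact_mod_cast smallCount_le ξ (N ω) l ω

variable [IsProbabilityMeasure P]

lemma integrable_boxIndicator (hξ : IsOccupancyScheme p ξ P) (hN : Measurable N) (k l : ℕ) :
    Integrable (fun ω => boxIndicator ξ (N ω) k l ω) P :=
  integrable_of_abs_le (hξ.measurable_boxIndicator hN k l) (ε := 1) fun ω => by
    rw [abs_of_nonneg (boxIndicator_nonneg _ _ _ _ _)]
    exact boxIndicator_le_one _ _ _ _ _

lemma integral_boxIndicator (hp : ∀ k, 0 ≤ p k) (hξ : IsOccupancyScheme p ξ P)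
    (hN : Measurable N) (hNlaw : HasLaw N (poissonMeasure r) P)
    (hind : IndepFun N (fun ω i => ξ i ω) P) (k l : ℕ) :
    ∫ ω, boxIndicator ξ (N ω) k l ω ∂P = poissonWeight l (r * p k) := by
  have hm := hξ.measurable_ballCount_randomIndex hN k
  have h : (fun ω => boxIndicator ξ (N ω) k l ω) =
      ((fun ω => ballCount ξ (N ω) k ω) ⁻¹' {l}).indicator fun _ => 1 := by
    ext ω
    by_cases hb : ballCount ξ (N ω) k ω = l <;> simp [boxIndicator, Set.indicator, hb]
  rw [h, integral_indicator_const _ (hm (measurableSet_singleton l)), smul_eq_mul, mul_one,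
    ← map_measureReal_apply hm (measurableSet_singleton l),
    (hξ.hasLaw_ballCount hp hN hNlaw hind k).map_eq, poissonMeasure_real_singleton, poissonWeight]
  simp [Real.coe_toNNReal _ (hp k)]

/-- It lets the mean of a count be subtracted box by box. -/
lemma hasSum_poissonWeight (hp : IsBoxDistribution p) (hξ : IsOccupancyScheme p ξ P)
    (hN : Measurable N) (hNlaw : HasLaw N (poissonMeasure r) P)
    (hind : IndepFun N (fun ω i => ξ i ω) P) (l : ℕ+) :
    HasSum (fun k => poissonWeight l (r * p k)) (∫ ω, (smallCount ξ (N ω) l ω : ℝ) ∂P) := by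
  have h := hasSum_integral_of_summable_integral_norm (μ := P)
    (F := fun k ω => boxIndicator ξ (N ω) k l ω)
    (fun k => hξ.integrable_boxIndicator hN k l) ?_
  · simp_rw [hξ.integral_boxIndicator hp.nonneg hN hNlaw hind,
      (hasSum_boxIndicator _ _ _ _).tsum_eq] at h
    exact h
  · simp_rw [Real.norm_of_nonneg (boxIndicator_nonneg _ _ _ _ _),
      hξ.integral_boxIndicator hp.nonneg hN hNlaw hind]
    exact summable_poissonWeight (fun k => mul_nonneg r.2 (hp.nonneg k))
      (hp.hasSum.summable.mul_left _) l

lemma integral_centered_boxIndicator_mul (hp : ∀ k, 0 ≤ p k) (hξ : IsOccupancyScheme p ξ P)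
    (hN : Measurable N) (hNlaw : HasLaw N (poissonMeasure r) P)
    (hind : IndepFun N (fun ω i => ξ i ω) P) (k l m : ℕ) :
    ∫ ω, (boxIndicator ξ (N ω) k l ω - poissonWeight l (r * p k)) *
      (boxIndicator ξ (N ω) k m ω - poissonWeight m (r * p k)) ∂P =
      poissonCov l m (r * p k) := by
  have hi (l : ℕ) := hξ.integrable_boxIndicator hN k l
  have he (l : ℕ) := hξ.integral_boxIndicator hp hN hNlaw hind k l
  have hil : Integrable (fun ω => if l = m then boxIndicator ξ (N ω) k l ω else 0) P := by
    split_ifs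
    · exact hi l
    · exact integrable_zero _ _ _
  have hel : ∫ ω, (if l = m then boxIndicator ξ (N ω) k l ω else 0) ∂P =
      if l = m then poissonWeight l (r * p k) else 0 := by
    split_ifs
    · exact he l
    · simp
  have h (ω : Ω) : (boxIndicator ξ (N ω) k l ω - poissonWeight l (r * p k)) *
      (boxIndicator ξ (N ω) k m ω - poissonWeight m (r * p k)) =
      (if l = m then boxIndicator ξ (N ω) k l ω else 0)
      - boxIndicator ξ (N ω) k l ω * poissonWeight m (r * p k)
      - poissonWeight l (r * p k) * (boxIndicator ξ (N ω) k m ω - poissonWeight m (r * p k)) := by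
    rw [← boxIndicator_mul]
    ring
  have h1 : Integrable (fun ω => (if l = m then boxIndicator ξ (N ω) k l ω else 0)
      - boxIndicator ξ (N ω) k l ω * poissonWeight m (r * p k)) P := hil.sub ((hi l).mul_const _)
  have h2 : Integrable (fun ω => poissonWeight l (r * p k) *
      (boxIndicator ξ (N ω) k m ω - poissonWeight m (r * p k))) P :=
    ((hi m).sub (integrable_const _)).const_mul _
  simp_rw [h]
  rw [integral_sub h1 h2, integral_sub hil ((hi l).mul_const _),
    integral_const_mul, integral_mul_const, integral_sub (hi m) (integrable_const _), hel, he, he,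
    poissonCov]
  simp

end IsOccupancyScheme

end Moments

/-! ### Linear combinations of centered counts -/

section BoxDeviation

/-- The contribution of box `k`, if it contains `n` balls, to the linear combination with
coefficients `t` of the centered counts. -/
noncomputable def boxDeviation (x : ℝ) (I : Finset ℕ+) (t : ℕ+ → ℝ) (n : ℕ) : ℝ :=
  ∑ l ∈ I, t l * ((if n = l then 1 else 0) - poissonWeight l x)

lemma poissonWeight_nonneg (l : ℕ) {x : ℝ} (hx : 0 ≤ x) : 0 ≤ poissonWeight l x := by
  rw [poissonWeight]
  positivity

lemma poissonWeight_le_one (l : ℕ) {x : ℝ} (hx : 0 ≤ x) : poissonWeight l x ≤ 1 :=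
  (hasSum_one_poissonMeasure ⟨x, hx⟩).summable.le_tsum l (fun n _ => poissonWeight_nonneg n hx)
    |>.trans_eq (hasSum_one_poissonMeasure ⟨x, hx⟩).tsum_eq

/-- An indicator and a probability differ by at most `1`. The bound depends neither on the box nor
on the time, so the terms become uniformly small after normalization. -/
lemma abs_boxDeviation_le {x : ℝ} (hx : 0 ≤ x) (I : Finset ℕ+) (t : ℕ+ → ℝ) (n : ℕ) :
    |boxDeviation x I t n| ≤ ∑ l ∈ I, |t l| := by
  refine (Finset.abs_sum_le_sum_abs _ _).trans (Finset.sum_le_sum fun l _ => ?_)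
  rw [abs_mul]
  refine mul_le_of_le_one_right (abs_nonneg _) ?_
  have h0 := poissonWeight_nonneg l hx
  have h1 := poissonWeight_le_one l hx
  rw [abs_le]
  split_ifs <;> constructor <;> linarith

variable {Ω : Type*} [MeasurableSpace Ω] {P : Measure Ω} [IsProbabilityMeasure P] {p : ℕ → ℝ}
  {ξ : ℕ → Ω → ℕ} {N : Ω → ℕ} {r : ℝ≥0}

namespace IsOccupancyScheme

lemma integral_boxDeviation (hp : ∀ k, 0 ≤ p k) (hξ : IsOccupancyScheme p ξ P)
    (hN : Measurable N) (hNlaw : HasLaw N (poissonMeasure r) P)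
    (hind : IndepFun N (fun ω i => ξ i ω) P) (I : Finset ℕ+) (t : ℕ+ → ℝ) (k : ℕ) :
    ∫ ω, boxDeviation (r * p k) I t (ballCount ξ (N ω) k ω) ∂P = 0 := by
  have hi (l : ℕ+) : Integrable (fun ω => boxIndicator ξ (N ω) k l ω - poissonWeight l (r * p k)) P :=
    (hξ.integrable_boxIndicator hN k l).sub (integrable_const _)
  change ∫ ω, ∑ l ∈ I, t l * (boxIndicator ξ (N ω) k l ω - poissonWeight l (r * p k)) ∂P = 0
  rw [integral_finsetSum _ fun l _ => (hi l).const_mul _]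
  refine Finset.sum_eq_zero fun l _ => ?_
  rw [integral_const_mul, integral_sub (hξ.integrable_boxIndicator hN k l) (integrable_const _),
    hξ.integral_boxIndicator hp hN hNlaw hind]
  simp

lemma integral_boxDeviation_sq (hp : ∀ k, 0 ≤ p k) (hξ : IsOccupancyScheme p ξ P)
    (hN : Measurable N) (hNlaw : HasLaw N (poissonMeasure r) P)
    (hind : IndepFun N (fun ω i => ξ i ω) P) (I : Finset ℕ+) (t : ℕ+ → ℝ) (k : ℕ) :
    ∫ ω, boxDeviation (r * p k) I t (ballCount ξ (N ω) k ω) ^ 2 ∂P =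
      ∑ l ∈ I, ∑ m ∈ I, t l * t m * poissonCov l m (r * p k) := by
  let D (l : ℕ+) (ω : Ω) : ℝ := boxIndicator ξ (N ω) k l ω - poissonWeight l (r * p k)
  have hD (l : ℕ+) : MemLp (D l) 2 P := by
    refine MemLp.sub (MemLp.of_bound
      (hξ.measurable_boxIndicator hN k l).aestronglyMeasurable 1 (Eventually.of_forall fun ω => ?_))
      (memLp_const _)
    rw [Real.norm_of_nonneg (boxIndicator_nonneg _ _ _ _ _)]
    exact boxIndicator_le_one _ _ _ _ _
  have hi (l m : ℕ+) : Integrable (fun ω => t l * t m * (D l ω * D m ω)) P :=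
    ((hD l).integrable_mul (hD m)).const_mul _
  have h (ω : Ω) : boxDeviation (r * p k) I t (ballCount ξ (N ω) k ω) ^ 2 =
      ∑ l ∈ I, ∑ m ∈ I, t l * t m * (D l ω * D m ω) := by
    change (∑ l ∈ I, t l * D l ω) ^ 2 = _
    rw [sq, Finset.sum_mul_sum]
    exact Finset.sum_congr rfl fun l _ => Finset.sum_congr rfl fun m _ => by ring
  simp_rw [h]
  rw [integral_finsetSum _ fun l _ => integrable_finsetSum _ fun m _ => hi l m]
  refine Finset.sum_congr rfl fun l _ => ?_
  rw [integral_finsetSum _ fun m _ => hi l m]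
  refine Finset.sum_congr rfl fun m _ => ?_
  rw [integral_const_mul, hξ.integral_centered_boxIndicator_mul hp hN hNlaw hind]

lemma hasSum_integral_boxDeviation_sq (hp : IsBoxDistribution p) (hξ : IsOccupancyScheme p ξ P)
    (hN : Measurable N) (hNlaw : HasLaw N (poissonMeasure r) P)
    (hind : IndepFun N (fun ω i => ξ i ω) P) (I : Finset ℕ+) (t : ℕ+ → ℝ) :
    HasSum (fun k => ∫ ω, boxDeviation (r * p k) I t (ballCount ξ (N ω) k ω) ^ 2 ∂P)
      (∑ l ∈ I, ∑ m ∈ I, t l * t m * ∑' k, poissonCov l m (r * p k)) := by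
  simp_rw [hξ.integral_boxDeviation_sq hp.nonneg hN hNlaw hind]
  exact hasSum_sum fun l _ => hasSum_sum fun m _ =>
    (summable_poissonCov (fun k => mul_nonneg r.2 (hp.nonneg k))
      (hp.hasSum.summable.mul_left _) l m).hasSum.mul_left _

/-- The series converges for every `ω`: only finitely many boxes are occupied, and the means are
summable. -/
lemma hasSum_boxDeviation (hp : IsBoxDistribution p) (hξ : IsOccupancyScheme p ξ P)
    (hN : Measurable N) (hNlaw : HasLaw N (poissonMeasure r) P)
    (hind : IndepFun N (fun ω i => ξ i ω) P) (I : Finset ℕ+) (t : ℕ+ → ℝ) (ω : Ω) :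
    HasSum (fun k => boxDeviation (r * p k) I t (ballCount ξ (N ω) k ω))
      (∑ l ∈ I, t l * ((smallCount ξ (N ω) l ω : ℝ) -
        ∫ ω', (smallCount ξ (N ω') l ω' : ℝ) ∂P)) :=
  hasSum_sum fun l _ => ((hasSum_boxIndicator ξ (N ω) l ω).sub
    (hξ.hasSum_poissonWeight hp hN hNlaw hind l)).mul_left _

/-- Quantitative central limit theorem for the characteristic function of a linear combination of
the counts of boxes with given occupancy, for a Poisson number of balls. -/
lemma norm_integral_exp_smallCount_sub_exp_le (hp : IsBoxDistribution p)
    (hξ : IsOccupancyScheme p ξ P) (hN : Measurable N) (hNlaw : HasLaw N (poissonMeasure r) P)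
    (hind : IndepFun N (fun ω i => ξ i ω) P) (I : Finset ℕ+) (t : ℕ+ → ℝ) {c : ℝ} (hc : 0 ≤ c)
    (hc1 : c * ∑ l ∈ I, |t l| ≤ 1) :
    ‖∫ ω, Complex.exp ((c * ∑ l ∈ I, t l * ((smallCount ξ (N ω) l ω : ℝ) -
        ∫ ω', (smallCount ξ (N ω') l ω' : ℝ) ∂P) : ℝ) * Complex.I) ∂P -
      Complex.exp ((-(c ^ 2 * (∑ l ∈ I, ∑ m ∈ I, t l * t m *
        ∑' k, poissonCov l m (r * p k)) / 2) : ℝ))‖ ≤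
      (c * ∑ l ∈ I, |t l|) * (c ^ 2 * (∑ l ∈ I, ∑ m ∈ I, t l * t m *
        ∑' k, poissonCov l m (r * p k))) := by
  have hx (k : ℕ) : 0 ≤ (r : ℝ) * p k := mul_nonneg r.2 (hp.nonneg k)
  have hmul (k : ℕ) : Measurable fun n => c * boxDeviation (r * p k) I t n := measurable_from_nat
  refine norm_integral_exp_hasSum_sub_exp_le
    (X := fun k ω => c * boxDeviation (r * p k) I t (ballCount ξ (N ω) k ω))
    (fun k => (hmul k).comp (hξ.measurable_ballCount_randomIndex hN k))
    ((hξ.iIndepFun_ballCount hN hNlaw hind).comp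
      (fun k n => c * boxDeviation (r * p k) I t n) hmul) hc1 (fun k ω => ?_) (fun k => ?_)
    (fun ω => (hξ.hasSum_boxDeviation hp hN hNlaw hind I t ω).mul_left c) ?_
  · rw [abs_mul, abs_of_nonneg hc]
    exact mul_le_mul_of_nonneg_left (abs_boxDeviation_le (hx k) I t _) hc
  · rw [integral_const_mul, hξ.integral_boxDeviation hp.nonneg hN hNlaw hind, mul_zero]
  · simp_rw [mul_pow, integral_const_mul]
    exact (hξ.hasSum_integral_boxDeviation_sq hp hN hNlaw hind I t).mul_left _

end IsOccupancyScheme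

end BoxDeviation

/-! ### The Gaussian limit -/

lemma integral_exp_sum_of_isGaussianProcess {ι Ω : Type*} [MeasurableSpace Ω] {P : Measure Ω}
    {Y : ι → Ω → ℝ} {c : ι → ι → ℝ} (hY : IsGaussianProcess Y P)
    (h0 : ∀ i, ∫ ω, Y i ω ∂P = 0) (hc : ∀ i j, ∫ ω, Y i ω * Y j ω ∂P = c i j)
    (I : Finset ι) (t : ι → ℝ) :
    ∫ ω, Complex.exp ((∑ i ∈ I, t i * Y i ω : ℝ) * Complex.I) ∂P =
      Complex.exp ((-((∑ i ∈ I, ∑ j ∈ I, t i * t j * c i j) / 2) : ℝ)) := by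
  have := hY.isProbabilityMeasure
  let Z (ω : Ω) : ℝ := ∑ i ∈ I, t i * Y i ω
  have hZ : HasGaussianLaw Z P := (hY.smul t).hasGaussianLaw_fun_sum (I := I)
  have hG (i : ι) : HasGaussianLaw (Y i) P := hY.hasGaussianLaw_eval i
  have hmean : ∫ ω, Z ω ∂P = 0 := by
    rw [integral_finsetSum _ fun i _ => (hG i).integrable.const_mul _]
    simp [integral_const_mul, h0]
  have hi (i j : ι) : Integrable (fun ω => t i * t j * (Y i ω * Y j ω)) P :=
    ((hG i).memLp_two.integrable_mul (hG j).memLp_two).const_mul _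
  have hvar : Var[Z; P] = ∑ i ∈ I, ∑ j ∈ I, t i * t j * c i j := by
    rw [variance_of_integral_eq_zero hZ.aemeasurable hmean]
    have h (ω : Ω) : (Z ^ 2) ω = ∑ i ∈ I, ∑ j ∈ I, t i * t j * (Y i ω * Y j ω) := by
      rw [Pi.pow_apply, sq, Finset.sum_mul_sum]
      exact Finset.sum_congr rfl fun l _ => Finset.sum_congr rfl fun m _ => by ring
    simp_rw [← Pi.pow_apply, h]
    rw [integral_finsetSum _ fun i _ => integrable_finsetSum _ fun j _ => hi i j]
    refine Finset.sum_congr rfl fun i _ => ?_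
    rw [integral_finsetSum _ fun j _ => hi i j]
    simp_rw [integral_const_mul, hc]
  have h := hZ.charFun_map_eq 1
  rw [charFun_apply_real, integral_map hZ.aemeasurable (by fun_prop)] at h
  simp only [Complex.ofReal_one, one_mul, Real.inner_apply] at h
  rw [hmean, hvar] at h
  refine h.trans ?_
  congr 1
  push_cast
  ring

theorem corollary1p6 {Ω : Type*} [MeasurableSpace Ω] (P : Measure Ω) [IsProbabilityMeasure P]
    (p : ℕ → ℝ) (hp : IsBoxDistribution p)
    (ξ : ℕ → Ω → ℕ) (hξ : IsOccupancyScheme p ξ P)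
    (π : ℝ≥0 → Ω → ℕ) (hπ : IsUnitPoissonProcess π P)
    (hindep : IndepFun (fun ω (t : ℝ≥0) => π t ω) (fun ω (i : ℕ) => ξ i ω) P)
    (g : ℝ → ℝ) (hg : IsSlowlyVarying g) (hg_top : Tendsto g atTop atTop)
    (hBarb : (fun t : ℝ => ∑' k, Set.indicator {k | p k ≤ t} p k)
      ~[𝓝[>] 0] fun t : ℝ => t * g (1 / t)) :
    (∀ (T : ℝ≥0) (l : ℕ+), Integrable (fun ω => (poissonSmallCount ξ π T l ω : ℝ)) P) ∧
    ∃ (Ω' : Type) (_ : MeasurableSpace Ω') (P' : Measure Ω') (_ : IsProbabilityMeasure P')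
      (Y : ℕ+ → Ω' → ℝ),
      IsGaussianProcess Y P' ∧
      (∀ l, ∫ ω, Y l ω ∂P' = 0) ∧
      (∀ l : ℕ+, ∫ ω, Y l ω ^ 2 ∂P' =
        1 / (l : ℝ) * (1 - (Nat.choose (2 * l) l : ℝ) * (1 / 2 ^ (2 * (l : ℕ) + 1)))) ∧
      (∀ l₁ l₂ : ℕ+, l₁ ≠ l₂ → ∫ ω, Y l₁ ω * Y l₂ ω ∂P' =
        -(1 / (((l₁ : ℝ) + (l₂ : ℝ)) * 2 ^ ((l₁ : ℕ) + (l₂ : ℕ)))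
          * (Nat.choose (l₁ + l₂) l₁ : ℝ))) ∧
      TendstoInDistribution
        (fun (T : ℝ≥0) (ω : Ω) (l : ℕ+) =>
          ((poissonSmallCount ξ π T l ω : ℝ) - ∫ ω', (poissonSmallCount ξ π T l ω' : ℝ) ∂P)
            / √(g T))
        atTop (fun (ω : Ω') (l : ℕ+) => Y l ω) (fun _ => P) P' := by
  have hB : lowMass p ~[𝓝[>] 0] fun t : ℝ => t * g (1 / t) := hBarb
  have hlaw (T : ℝ≥0) : HasLaw (π T) (poissonMeasure T) P := by
    have h := hπ.law 0 T zero_le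
    rw [tsub_zero] at h
    refine h.congr ?_
    filter_upwards [hπ.zero] with ω hω
    rw [hω, Nat.sub_zero]
  have hind (T : ℝ≥0) : IndepFun (π T) (fun ω i => ξ i ω) P :=
    hindep.comp (measurable_pi_apply T) measurable_id
  have hlim (I : Finset ℕ+) (t : ℕ+ → ℝ) : Tendsto (fun T : ℝ≥0 =>
      1 / g T * ∑ l ∈ I, ∑ m ∈ I, t l * t m * ∑' k, poissonCov l m (T * p k)) atTop
      (𝓝 (∑ l ∈ I, ∑ m ∈ I, t l * t m * limitCov l m)) := by
    have h := tendsto_finsetSum I fun l _ => tendsto_finsetSum I fun m _ =>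
      ((tendsto_tsum_poissonCov hp hg hB l m).comp
        (NNReal.tendsto_coe_atTop.2 tendsto_id)).const_mul (t l * t m)
    refine h.congr fun T => ?_
    simp_rw [Finset.mul_sum]
    refine Finset.sum_congr rfl fun l _ => Finset.sum_congr rfl fun m _ => ?_
    simp only [Function.comp_apply, id]
    ring
  have hgT : Tendsto (fun T : ℝ≥0 => g T) atTop atTop :=
    hg_top.comp (NNReal.tendsto_coe_atTop.2 tendsto_id)
  -- The quadratic form is a limit of variances divided by `g T`, hence nonnegative.
  have hpos (I : Finset ℕ+) (t : ℕ+ → ℝ) :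
      0 ≤ ∑ l ∈ I, ∑ m ∈ I, t l * t m * limitCov l m := by
    refine ge_of_tendsto (hlim I t) ?_
    filter_upwards [hgT.eventually_gt_atTop 0] with T hT
    refine mul_nonneg (by positivity) ?_
    exact (hξ.hasSum_integral_boxDeviation_sq hp (hπ.measurable T) (hlaw T) (hind T) I t).nonneg
      fun k => integral_nonneg fun ω => sq_nonneg _
  refine ⟨fun T l => hξ.integrable_smallCount (hπ.measurable T) (hlaw T) l, ?_⟩
  obtain ⟨Ω', mΩ', P', hP', Y, hYG, hYm, hY0, hYc⟩ :=
    exists_isGaussianProcess limitCov_comm hpos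
  refine ⟨Ω', mΩ', P', hP', Y, hYG, hY0, fun l => ?_, fun l m hlm => ?_, ?_⟩
  · simp_rw [sq]
    rw [hYc, limitCov, if_pos rfl, two_mul]
    field_simp
    ring
  · rw [hYc, limitCov, if_neg hlm, zero_sub]
  · refine tendstoInDistribution_pi_of_tendsto_charFun (fun T => ?_)
      (measurable_pi_iff.2 hYm).aemeasurable fun I t => ?_
    · exact (measurable_pi_iff.2 fun l => ((hξ.measurable_smallCount (hπ.measurable T) l).sub_const
        _).div_const _).aemeasurable
    rw [integral_exp_sum_of_isGaussianProcess hYG hY0 hYc]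
    have hc : Tendsto (fun T : ℝ≥0 => 1 / √(g T) * ∑ l ∈ I, |t l|) atTop (𝓝 0) := by
      have h := (Real.tendsto_sqrt_atTop.comp hgT).inv_tendsto_atTop.mul_const (∑ l ∈ I, |t l|)
      rw [zero_mul] at h
      exact h.congr fun T => by simp
    have hexp := (Complex.continuous_exp.comp Complex.continuous_ofReal).continuousAt.tendsto.comp
      ((hlim I t).div_const 2).neg
    -- The error bound is a vanishing bound on the terms times a convergent variance; the scale `c =
    -- 1 / √(g T)` gives `c ^ 2 = 1 / g T`.
    have herr := hc.mul (hlim I t)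
    rw [zero_mul] at herr
    refine tendsto_of_tendsto_of_dist hexp (squeeze_zero' (Eventually.of_forall fun T =>
      dist_nonneg) ?_ herr)
    filter_upwards [hgT.eventually_gt_atTop 0, hc.eventually_le_const one_pos] with T hT hc1
    have h := hξ.norm_integral_exp_smallCount_sub_exp_le hp (hπ.measurable T) (hlaw T) (hind T) I t
      (by positivity) hc1
    rw [one_div_pow, Real.sq_sqrt hT.le, ← dist_eq_norm, dist_comm] at h
    have hsum (ω : Ω) : ∑ l ∈ I, t l * (((poissonSmallCount ξ π T l ω : ℝ) -
        ∫ ω', (poissonSmallCount ξ π T l ω' : ℝ) ∂P) / √(g T)) =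
        1 / √(g T) * ∑ l ∈ I, t l * ((smallCount ξ (π T ω) l ω : ℝ) -
        ∫ ω', (smallCount ξ (π T ω') l ω' : ℝ) ∂P) := by
      rw [Finset.mul_sum]
      refine Finset.sum_congr rfl fun l _ => ?_
      simp only [poissonSmallCount]
      ring
    simp_rw [hsum]
    exact h
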